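/- Let $\epsilon_1,\gamma_1:[0,1]\to\mathbb{R}$ be twice continuously differentiable with $\epsilon_1>0$ and $\gamma_1\ge 0$ on $[0,1]$, and for $k\in\mathbb{C}$ let $y(r)=y(r;k)$ be the solution on $[0,1]$ of $$y''+\bigl(k^2\epsilon_1(r)+ik\gamma_1(r)\bigr)y=0,\qquad y(0)=0,\quad y'(0)=1,$$ where $'$ denotes $d/dr$. Put $$B=\int_0^1\sqrt{\epsilon_1(\rho)}\,d\rho,\qquad D=\frac12\int_0^1\frac{\gamma_1(\rho)}{\sqrt{\epsilon_1(\rho)}}\,d\rho .$$ Then $k\mapsto y(1;k)$ and $k\mapsto y'(1;k)$ are entire functions, and: (i) all zeros of $y(1;k)$, repeated according to multiplicity, can be listed as $(z_j)_{j\in\mathbb{Z}\setminus\{0\}}$ so that $$z_j=\frac{j\pi}{B}-\frac{iD}{B}+O\Bigl(\frac1{|j|}\Bigr),\qquad j\in\mathbb{Z}\setminus\{0\};$$ (ii) all zeros of $y'(1;k)$, repeated according to multiplicity, can be listed as $(z'_j)_{j\in\mathbb{Z}}$ so that $$z'_j=\frac{(j-\frac12)\pi}{B}-\frac{iD}{B}+O\Bigl(\frac1{|j|}\Bigr),\qquad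 j\in\mathbb{Z}\setminus\{0\}.$$ The constants implied in $O(1/|j|)$ depend only on $\epsilon_1$ and $\gamma_1$. -/

import Mathlib

open Set

namespace InteriorTransmission

/-- `u`, with derivative `u'`, solves on `[0,1]` the initial value problem
`u'' + k² (ε + i γ / k) u = 0`, `u 0 = 0`, `u' 0 = 1`.
The potential is written in the expanded form `k² ε + i k γ`, which also makes sense at `k = 0`.
Derivatives at the end points are one-sided. -/
structure IsSolution (ε γ : ℝ → ℝ) (k : ℂ) (u u' : ℝ → ℂ) : Prop where
  hasDeriv : ∀ r ∈ Icc (0 : ℝ) 1, HasDerivWithinAt u (u' r) (Icc 0 1) r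
  hasDeriv' : ∀ r ∈ Icc (0 : ℝ) 1,
    HasDerivWithinAt u'
      (-((k ^ 2 * (ε r : ℂ) + Complex.I * k * (γ r : ℂ)) * u r)) (Icc 0 1) r
  init : u 0 = 0
  init' : u' 0 = 1

/-- `B = ∫₀¹ √ε`. -/
noncomputable def constB (ε : ℝ → ℝ) : ℝ := ∫ ρ in (0 : ℝ)..1, √(ε ρ)

/-- `D = ½ ∫₀¹ γ / √ε`. -/
noncomputable def constD (ε γ : ℝ → ℝ) : ℝ := 1 / 2 * ∫ ρ in (0 : ℝ)..1, γ ρ / √(ε ρ)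

/-- `f` is entire and the family `(z j)`, `j ∈ J`, lists all zeros of `f`, each one exactly as many
times as its multiplicity (and nothing else, since the order of `f` is `0` off its zeros). -/
def EnumeratesZeros (f : ℂ → ℂ) (J : Set ℤ) (z : ℤ → ℂ) : Prop :=
  Differentiable ℂ f ∧ ∀ w : ℂ, {j : ℤ | j ∈ J ∧ z j = w}.encard = analyticOrderAt f w

end InteriorTransmission

/-!
The Liouville–Green approximation replaces `y` and `y'` by the two waves
`ε ^ (-1/4) exp (± ∫ (i k √ε - γ / (2 √ε)))`: the corresponding combinations of `y` and `y'` satisfy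
two scalar equations whose coupling is `O(1/|k|)`, so that, up to nonzero constant factors,
`k y(1; k)` and `y'(1; k)` differ from `sin (B k + i D)` and `cos (B k + i D)` by
`O(exp (B |Im k|) / |k|)`. Away from its zeros `|sin w|` is at least a multiple of `exp |Im w|`, so
Rouché's theorem on one large disc about the origin and on unit discs about the remaining multiples
of `π` matches the zeros with those of the sine, multiplicities included, and the size of the error
at a zero then improves the distance to `O(1/|j|)`. The zero of `k y(1; k)` at the origin is an
artefact, and is removed by giving it the index `0`.
-/

namespace InteriorTransmission

open Filter Topology Asymptotics Bornology

section ZeroMultisets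

/-- `S` lists the zeros of `f` in `K`, each one as many times as its multiplicity. -/
structure IsMultisetOfZeros (f : ℂ → ℂ) (K : Set ℂ) (S : Multiset ℂ) : Prop where
  mem : ∀ a ∈ S, a ∈ K
  analyticOrderAt_eq : ∀ a ∈ K, analyticOrderAt f a = S.count a

variable {f g : ℂ → ℂ} {K : Set ℂ} {S T : Multiset ℂ} {a c : ℂ} {R : ℝ}

lemma analyticAt_dslope {z : ℂ} (ha : AnalyticAt ℂ f a) (hz : AnalyticAt ℂ f z) :
    AnalyticAt ℂ (dslope f a) z := by
  rcases eq_or_ne z a with rfl | hza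
  · exact hz.elim fun p hp => hp.has_fpower_series_dslope_fslope.analyticAt
  · refine AnalyticAt.congr (f := fun w => (w - a)⁻¹ • (f w - f a)) ?_ ?_
    · exact ((analyticAt_id.sub analyticAt_const).inv (sub_ne_zero.2 hza)).smul
        (hz.sub analyticAt_const)
    · filter_upwards [isOpen_ne.mem_nhds hza] with w hw
      rw [dslope_of_ne _ hw, slope_def_module]

lemma eq_sub_mul_dslope (ha : f a = 0) : f = (fun z => z - a) * dslope f a :=
  funext fun z => by simpa [ha] using (sub_smul_dslope f a z).symm

lemma analyticOrderAt_sub_const (a z : ℂ) :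
    analyticOrderAt (fun w : ℂ => w - a) z = ({a} : Multiset ℂ).count z := by
  rcases eq_or_ne z a with rfl | hza
  · simp [analyticOrderAt_id_sub_const_self]
  · have hlin : AnalyticAt ℂ (fun w : ℂ => w - a) z := by fun_prop
    simp [hza, hlin.analyticOrderAt_eq_zero.2 (sub_ne_zero.2 hza)]

lemma exists_isMultisetOfZeros (hf : AnalyticOnNhd ℂ f K) (hK : IsCompact K)
    (hord : ∀ a ∈ K, analyticOrderAt f a ≠ ⊤) : ∃ S, IsMultisetOfZeros f K S := by
  have hfin : {z | z ∈ K ∧ f z = 0}.Finite := by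
    by_contra hinf
    obtain ⟨x, hxK, hx⟩ := Set.Infinite.exists_accPt_of_subset_isCompact hinf hK fun z hz => hz.1
    have hfreq : ∃ᶠ z in 𝓝[≠] x, f z = 0 :=
      (accPt_iff_frequently_nhdsNE.1 hx).mono fun z hz => hz.2
    exact hord x hxK <|
      analyticOrderAt_eq_top.2 ((hf x hxK).frequently_zero_iff_eventually_zero.1 hfreq)
  refine ⟨∑ a ∈ hfin.toFinset, Multiset.replicate (analyticOrderNatAt f a) a,
    fun a ha => ?_, fun a ha => ?_⟩
  · obtain ⟨b, hb, hab⟩ := Multiset.mem_sum.1 ha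
    rw [Multiset.eq_of_mem_replicate hab]
    exact (hfin.mem_toFinset.1 hb).1
  · simp only [Multiset.count_sum', Multiset.count_replicate, Finset.sum_ite_eq',
      Finite.mem_toFinset, mem_ofPred_eq, ha, true_and]
    split_ifs with h0
    · exact (Nat.cast_analyticOrderNatAt (hord a ha)).symm
    · simpa using (hf a ha).analyticOrderAt_eq_zero.2 h0

namespace IsMultisetOfZeros

lemma eq_zero_of_mem (hS : IsMultisetOfZeros f K S) (ha : a ∈ S) : f a = 0 := by
  refine apply_eq_zero_of_analyticOrderAt_ne_zero ?_
  rw [hS.analyticOrderAt_eq a (hS.mem a ha)]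
  exact_mod_cast (Multiset.count_pos.2 ha).ne'

lemma ne_zero (hS : IsMultisetOfZeros f K 0) (hf : AnalyticOnNhd ℂ f K) (ha : a ∈ K) :
    f a ≠ 0 :=
  (hf a ha).analyticOrderAt_eq_zero.1 (by simpa using hS.analyticOrderAt_eq a ha)

lemma of_cons (hS : IsMultisetOfZeros f K (a ::ₘ S)) (hf : AnalyticOnNhd ℂ f K) :
    IsMultisetOfZeros (dslope f a) K S := by
  refine ⟨fun b hb => hS.mem b (Multiset.mem_cons_of_mem hb), fun b hb => ?_⟩
  have ha : a ∈ K := hS.mem a (Multiset.mem_cons_self a S)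
  have hmul : analyticOrderAt f b = analyticOrderAt (fun z => z - a) b
      + analyticOrderAt (dslope f a) b := by
    rw [← analyticOrderAt_mul (by fun_prop) (analyticAt_dslope (hf a ha) (hf b hb)),
      ← eq_sub_mul_dslope (hS.eq_zero_of_mem (Multiset.mem_cons_self a S))]
  rw [hS.analyticOrderAt_eq b hb, analyticOrderAt_sub_const, ← Multiset.singleton_add,
    Multiset.count_add, Nat.cast_add] at hmul
  exact ENat.add_right_injective_of_ne_top (ENat.natCast_ne_top _) hmul.symm

end IsMultisetOfZeros

lemma continuousOn_logDeriv (hf : AnalyticOnNhd ℂ f K) (h0 : ∀ z ∈ K, f z ≠ 0) :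
    ContinuousOn (logDeriv f) K :=
  hf.deriv.continuousOn.div hf.continuousOn h0

open Metric in
theorem circleIntegral_logDeriv (hR : 0 ≤ R) (hf : AnalyticOnNhd ℂ f (closedBall c R))
    (h0 : ∀ z ∈ sphere c R, f z ≠ 0) (hS : IsMultisetOfZeros f (closedBall c R) S) :
    ∮ z in C(c, R), logDeriv f z = 2 * Real.pi * Complex.I * S.card := by
  induction S using Multiset.induction_on generalizing f with
  | empty =>
    have hne : ∀ z ∈ closedBall c R, f z ≠ 0 := fun z hz => hS.ne_zero hf hz
    rw [Multiset.card_zero, Nat.cast_zero, mul_zero]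
    refine Complex.circleIntegral_eq_zero_of_differentiable_on_off_countable hR
      countable_empty (continuousOn_logDeriv hf hne) fun z hz => ?_
    have hz := ball_subset_closedBall hz.1
    exact (hf z hz).deriv.differentiableAt.div (hf z hz).differentiableAt (hne z hz)
  | cons a S ih =>
    have ha : a ∈ closedBall c R := hS.mem a (Multiset.mem_cons_self a S)
    have hfa : f = (fun z => z - a) * dslope f a :=
      eq_sub_mul_dslope (hS.eq_zero_of_mem (Multiset.mem_cons_self a S))
    have hg : AnalyticOnNhd ℂ (dslope f a) (closedBall c R) :=
      fun z hz => analyticAt_dslope (hf a ha) (hf z hz)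
    have hne : ∀ z ∈ sphere c R, z - a ≠ 0 ∧ dslope f a z ≠ 0 := fun z hz =>
      mul_ne_zero_iff.1 (by rw [← Pi.mul_apply (fun z => z - a), ← hfa]; exact h0 z hz)
    have hab : a ∈ ball c R := (ball_union_sphere (x := c) ▸ ha).resolve_right fun h =>
      (hne a h).1 (sub_self a)
    have hlog : ∀ z ∈ sphere c R, logDeriv f z = (z - a)⁻¹ + logDeriv (dslope f a) z := by
      intro z hz
      conv_lhs => rw [hfa]
      refine (logDeriv_mul z (hne z hz).1 (hne z hz).2 (by fun_prop)
        (hg z (sphere_subset_closedBall hz)).differentiableAt).trans ?_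
      simp [logDeriv_apply]
    rw [circleIntegral.integral_congr hR hlog, circleIntegral.integral_add,
      circleIntegral.integral_sub_inv_of_mem_ball hab, ih hg (fun z hz => (hne z hz).2)
        (hS.of_cons hf), Multiset.card_cons]
    · push_cast; ring
    · exact (ContinuousOn.inv₀ (by fun_prop) fun z hz => (hne z hz).1).circleIntegrable hR
    · exact (continuousOn_logDeriv (hg.mono sphere_subset_closedBall)
        fun z hz => (hne z hz).2).circleIntegrable hR

open Metric in
theorem rouche (hR : 0 ≤ R)
    (hf : AnalyticOnNhd ℂ f (closedBall c R)) (hg : AnalyticOnNhd ℂ g (closedBall c R))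
    (hS : IsMultisetOfZeros f (closedBall c R) S) (hT : IsMultisetOfZeros g (closedBall c R) T)
    (hlt : ∀ z ∈ sphere c R, ‖f z - g z‖ < ‖g z‖) : S.card = T.card := by
  have hg0 : ∀ z ∈ sphere c R, g z ≠ 0 := fun z hz =>
    norm_pos_iff.1 ((norm_nonneg _).trans_lt (hlt z hz))
  have hf0 : ∀ z ∈ sphere c R, f z ≠ 0 := fun z hz h => by simpa [h] using hlt z hz
  have hprim : ∀ z ∈ sphere c R, HasDerivWithinAt (fun z => Complex.log (f z / g z))
      (logDeriv f z - logDeriv g z) (sphere c R) z := by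
    intro z hz
    have hslit : f z / g z ∈ Complex.slitPlane := by
      have h1 : ‖f z / g z - 1‖ < 1 := by
        rw [div_sub_one (hg0 z hz), norm_div, div_lt_one (norm_pos_iff.2 (hg0 z hz))]
        exact hlt z hz
      simpa using Complex.mem_slitPlane_of_norm_lt_one h1
    have hz' := sphere_subset_closedBall hz
    have hd := ((hf z hz').differentiableAt.hasDerivAt.div
      (hg z hz').differentiableAt.hasDerivAt (hg0 z hz)).clog hslit
    refine (hd.congr_deriv ?_).hasDerivWithinAt
    have := hf0 z hz
    have := hg0 z hz
    simp only [logDeriv_apply, Pi.div_apply]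
    field_simp
  have hint : ∀ {h : ℂ → ℂ}, AnalyticOnNhd ℂ h (closedBall c R) → (∀ z ∈ sphere c R, h z ≠ 0) →
      CircleIntegrable (logDeriv h) c R := fun hh h0 =>
    (continuousOn_logDeriv (hh.mono sphere_subset_closedBall) h0).circleIntegrable hR
  have hzero := circleIntegral.integral_eq_zero_of_hasDerivWithinAt hR hprim
  rw [circleIntegral.integral_sub (hint hf hf0) (hint hg hg0), circleIntegral_logDeriv hR hf hf0 hS,
    circleIntegral_logDeriv hR hg hg0 hT, ← mul_sub] at hzero
  exact_mod_cast sub_eq_zero.1 ((mul_eq_zero.1 hzero).resolve_left Complex.two_pi_I_ne_zero)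

end ZeroMultisets

section Enumerations

variable {f g : ℂ → ℂ} {w : ℤ → ℂ}

lemma exists_map_eq_of_card_eq {α β : Type*} [Nonempty β] (J : Finset α)
    (S : Multiset β) (h : S.card = J.card) : ∃ f : α → β, J.val.map f = S := by
  classical
  induction J using Finset.induction_on generalizing S with
  | empty => exact ⟨fun _ => Classical.arbitrary β, by simpa [eq_comm] using h⟩
  | insert a J ha ih =>
    rw [Finset.card_insert_of_notMem ha] at h
    obtain ⟨b, hb⟩ := Multiset.card_pos_iff_exists_mem.1 (by omega : 0 < S.card)
    obtain ⟨S, rfl⟩ := Multiset.exists_cons_of_mem hb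
    obtain ⟨f, rfl⟩ := ih S (by simpa using h)
    refine ⟨Function.update f a b, ?_⟩
    rw [Finset.insert_val_of_notMem ha, Multiset.map_cons, Function.update_self]
    congr 1
    exact Multiset.map_congr rfl fun x hx =>
      Function.update_of_ne (ne_of_mem_of_not_mem hx ha) _ _

lemma encard_fiber_eq_count_map {α β : Type*} [DecidableEq β] (J : Finset α) (f : α → β) (b : β) :
    {j | j ∈ J ∧ f j = b}.encard = (J.val.map f).count b := by
  have : {j | j ∈ J ∧ f j = b} = (J.filter fun j => b = f j : Finset α) := by
    ext j; simp [eq_comm]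
  rw [this, encard_coe_eq_coe_finsetCard, Multiset.count_map]
  rfl

namespace EnumeratesZeros

lemma encard_fiber (h : EnumeratesZeros g univ w) (a : ℂ) :
    {j | w j = a}.encard = analyticOrderAt g a := by simpa using h.2 a

lemma apply_eq_zero (h : EnumeratesZeros g univ w) (j : ℤ) : g (w j) = 0 := by
  refine apply_eq_zero_of_analyticOrderAt_ne_zero ?_
  rw [← h.encard_fiber]
  exact encard_ne_zero.2 ⟨j, rfl⟩

lemma exists_finset_map_eq {K : Set ℂ} {T : Multiset ℂ} (h : EnumeratesZeros g univ w)
    (hT : IsMultisetOfZeros g K T) :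
    ∃ J : Finset ℤ, (∀ j, j ∈ J ↔ w j ∈ K) ∧ J.val.map w = T := by
  have hcount : ∀ a ∈ K, {j | w j = a}.encard = T.count a := fun a ha => by
    rw [h.encard_fiber, hT.analyticOrderAt_eq a ha]
  have hmem : ∀ j, w j ∈ K ↔ w j ∈ T := by
    refine fun j => ⟨fun hj => Multiset.count_pos.1 ?_, hT.mem (w j)⟩
    rw [← Nat.cast_pos (α := ℕ∞), ← hcount _ hj, encard_pos]
    exact ⟨j, rfl⟩
  have hfin : {j | w j ∈ K}.Finite := by
    have : {j | w j ∈ K} = ⋃ a ∈ T.toFinset, {j | w j = a} := by ext j; simp [hmem]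
    rw [this]
    refine T.toFinset.finite_toSet.biUnion fun a ha => finite_of_encard_eq_coe (k := T.count a) ?_
    exact hcount a (hT.mem a (by simpa using ha))
  refine ⟨hfin.toFinset, fun j => by simp, Multiset.ext.2 fun a => ?_⟩
  rw [← Nat.cast_inj (R := ℕ∞), ← encard_fiber_eq_count_map]
  simp only [Finite.mem_toFinset, mem_ofPred_eq]
  by_cases ha : a ∈ K
  · rw [← hcount a ha]
    congr 1
    ext j
    exact and_iff_right_of_imp fun hj => hj ▸ ha
  · rw [Multiset.count_eq_zero_of_notMem fun h => ha (hT.mem a h), Nat.cast_zero, encard_eq_zero]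
    exact eq_empty_of_forall_notMem fun j hj => ha (hj.2 ▸ hj.1)

theorem exists_of_pairwise_disjoint {κ : Type*} {K : κ → Set ℂ} {S T : κ → Multiset ℂ}
    (hw : EnumeratesZeros g univ w) (hf : Differentiable ℂ f)
    (hdisj : Pairwise (Function.onFun Disjoint K)) (hfK : ∀ a, f a = 0 → ∃ k, a ∈ K k)
    (hwK : ∀ j, ∃ k, w j ∈ K k) (hS : ∀ k, IsMultisetOfZeros f (K k) (S k))
    (hT : ∀ k, IsMultisetOfZeros g (K k) (T k)) (hcard : ∀ k, (S k).card = (T k).card) :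
    ∃ z, EnumeratesZeros f univ z ∧ ∀ j k, w j ∈ K k → z j ∈ K k := by
  choose J hJ hJT using fun k => hw.exists_finset_map_eq (hT k)
  choose φ hφ using fun k => exists_map_eq_of_card_eq (J k) (S k)
    (by rw [hcard, ← hJT, Multiset.card_map, Finset.card_val])
  choose p hp using hwK
  have hunique : ∀ {a k l}, a ∈ K k → a ∈ K l → k = l := fun hk hl =>
    hdisj.eq (not_disjoint_iff.2 ⟨_, hk, hl⟩)
  have hzK : ∀ j, φ (p j) j ∈ K (p j) := fun j =>
    (hS _).mem _ (hφ (p j) ▸ Multiset.mem_map_of_mem _ ((hJ _ j).2 (hp j)))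
  refine ⟨fun j => φ (p j) j, ⟨hf, fun a => ?_⟩, fun j k hk => hunique hk (hp j) ▸ hzK j⟩
  by_cases ha : ∃ k, a ∈ K k
  · obtain ⟨k, ha⟩ := ha
    rw [(hS k).analyticOrderAt_eq a ha, ← hφ, ← encard_fiber_eq_count_map]
    congr 1
    ext j
    simp only [mem_univ, true_and, mem_ofPred_eq, hJ]
    constructor
    · rintro rfl
      obtain rfl := hunique (hzK j) ha
      exact ⟨hp j, rfl⟩
    · rintro ⟨hj, rfl⟩
      rw [hunique (hp j) hj]
  · rw [(hf.analyticAt a).analyticOrderAt_eq_zero.2 fun h => ha (hfK a h), encard_eq_zero]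
    exact eq_empty_of_forall_notMem fun j hj => ha ⟨p j, hj.2 ▸ hzK j⟩

open Metric in
theorem exists_of_norm_sub_lt {κ : Type*} {c : κ → ℂ} {R : κ → ℝ}
    (hw : EnumeratesZeros g univ w) (hf : Differentiable ℂ f) (hR : ∀ k, 0 ≤ R k)
    (hdisj : Pairwise (Function.onFun Disjoint fun k => closedBall (c k) (R k)))
    (hfK : ∀ a, f a = 0 → ∃ k, a ∈ closedBall (c k) (R k))
    (hwK : ∀ j, ∃ k, w j ∈ closedBall (c k) (R k))
    (hlt : ∀ k, ∀ a ∈ sphere (c k) (R k), ‖f a - g a‖ < ‖g a‖) :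
    ∃ z, EnumeratesZeros f univ z ∧
      ∀ j k, w j ∈ closedBall (c k) (R k) → z j ∈ closedBall (c k) (R k) := by
  have hzeros : ∀ {h : ℂ → ℂ}, Differentiable ℂ h → ∀ k, (∃ a, h a ≠ 0) →
      ∃ S, IsMultisetOfZeros h (closedBall (c k) (R k)) S := fun {h} hh k ⟨b, hb⟩ => by
    refine exists_isMultisetOfZeros (fun a _ => hh.analyticAt a) (isCompact_closedBall _ _)
      fun a _ htop => ?_
    exact hb (congrFun ((AnalyticOnNhd.analyticOrderAt_eq_top_iff_eq_zero a
      fun z => hh.analyticAt z).1 htop) b)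
  have hpt : ∀ _ : κ, ∃ a, f a ≠ 0 ∧ g a ≠ 0 := fun k => by
    obtain ⟨a, ha⟩ := NormedSpace.sphere_nonempty (x := c k).2 (hR k)
    have := hlt k a ha
    exact ⟨a, fun h => by simp [h] at this, norm_pos_iff.1 ((norm_nonneg _).trans_lt this)⟩
  choose S hS using fun k => hzeros hf k ((hpt k).imp fun _ => And.left)
  choose T hT using fun k => hzeros hw.1 k ((hpt k).imp fun _ => And.right)
  exact hw.exists_of_pairwise_disjoint hf hdisj hfK hwK hS hT fun k =>
    rouche (hR k) (fun a _ => hf.analyticAt a) (fun a _ => hw.1.analyticAt a) (hS k) (hT k) (hlt k)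

end EnumeratesZeros

end Enumerations

section Sine

open Metric

lemma norm_sin_sq (z : ℂ) :
    ‖Complex.sin z‖ ^ 2 = Real.sin z.re ^ 2 + Real.sinh z.im ^ 2 := by
  have h : Complex.sin z = ⟨Real.sin z.re * Real.cosh z.im, Real.cos z.re * Real.sinh z.im⟩ := by
    rw [Complex.sin_eq]
    apply Complex.ext <;> simp [← Complex.ofReal_sin, ← Complex.ofReal_cos,
      ← Complex.ofReal_sinh, ← Complex.ofReal_cosh]
  rw [h, ← Complex.normSq_eq_norm_sq, Complex.normSq_mk]
  linear_combination Real.sin z.re ^ 2 * Real.cosh_sq z.im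
    + Real.sinh z.im ^ 2 * Real.sin_sq_add_cos_sq z.re

lemma norm_div_two_le_norm_sin {z : ℂ} (hz : |z.re| ≤ Real.pi / 2) :
    ‖z‖ / 2 ≤ ‖Complex.sin z‖ := by
  have hsin : 1 / 2 * |z.re| ≤ |Real.sin z.re| := by
    refine le_trans (mul_le_mul_of_nonneg_right ?_ (abs_nonneg _)) (Real.mul_abs_le_abs_sin hz)
    rw [div_le_div_iff₀ two_pos Real.pi_pos]
    linarith [Real.pi_le_four]
  have hsinh : |z.im| ≤ |Real.sinh z.im| := by
    rw [Real.abs_sinh]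
    exact Real.self_le_sinh_iff.2 (abs_nonneg _)
  refine (abs_le_of_sq_le_sq' ?_ (norm_nonneg _)).2
  rw [norm_sin_sq, div_pow, ← Complex.normSq_eq_norm_sq, Complex.normSq_apply,
    ← sq_abs (Real.sin _), ← sq_abs (Real.sinh _)]
  have hsin' := pow_le_pow_left₀ (by positivity) hsin 2
  have hsinh' := pow_le_pow_left₀ (by positivity) hsinh 2
  rw [mul_pow, sq_abs] at hsin'
  rw [sq_abs] at hsinh'
  nlinarith [sq_nonneg z.im]

lemma exp_abs_im_div_four_le_norm_sin {z : ℂ} (hz : 1 ≤ |z.im|) :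
    Real.exp |z.im| / 4 ≤ ‖Complex.sin z‖ :=
  calc Real.exp |z.im| / 4 ≤ Real.sinh |z.im| := by
        rw [Real.sinh_eq]
        linarith [Real.exp_le_one_iff.2 (neg_nonpos.2 (abs_nonneg z.im)),
          Real.add_one_le_exp |z.im|]
    _ ≤ ‖Complex.sin z‖ := by
        rw [← Real.abs_sinh]
        refine (abs_le_of_sq_le_sq' ?_ (norm_nonneg _)).2
        rw [sq_abs, norm_sin_sq]
        exact le_add_of_nonneg_left (sq_nonneg _)

lemma le_norm_sin_of_abs_re_le {z : ℂ} {d : ℝ} (hz : |z.re| ≤ Real.pi / 2) (hd : d ≤ 1)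
    (hdz : d ≤ ‖z‖) : d / 6 * Real.exp |z.im| ≤ ‖Complex.sin z‖ := by
  rcases le_total 1 |z.im| with him | him
  · have := exp_abs_im_div_four_le_norm_sin him
    nlinarith [Real.exp_pos |z.im|]
  · have he : Real.exp |z.im| ≤ 3 := by linarith [Real.exp_le_exp.2 him, Real.exp_one_lt_d9]
    have := norm_div_two_le_norm_sin hz
    nlinarith [Real.exp_pos |z.im|, norm_nonneg z]

lemma le_norm_sin {z : ℂ} {d : ℝ} (hd : d ≤ 1) (hdz : ∀ j : ℤ, d ≤ ‖z - j * Real.pi‖) :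
    d / 6 * Real.exp |z.im| ≤ ‖Complex.sin z‖ := by
  set j : ℤ := round (z.re / Real.pi)
  have hre : |(z - j * Real.pi).re| ≤ Real.pi / 2 := by
    have h : (z - j * Real.pi).re = (z.re / Real.pi - j) * Real.pi := by
      simp [sub_mul, Real.pi_ne_zero]
    rw [h, abs_mul, abs_of_pos Real.pi_pos]
    nlinarith [abs_sub_round (z.re / Real.pi), Real.pi_pos]
  have hsin : ‖Complex.sin (z - j * Real.pi)‖ = ‖Complex.sin z‖ := by
    rw [Complex.sin_antiperiodic.sub_int_mul_eq]
    simp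
  simpa [hsin] using le_norm_sin_of_abs_re_le hre hd (hdz j)

lemma norm_int_mul_pi (j : ℤ) : ‖(j : ℂ) * Real.pi‖ = |(j : ℝ)| * Real.pi := by
  rw [norm_mul, Complex.norm_real, Real.norm_of_nonneg Real.pi_pos.le, Complex.norm_intCast]

lemma enumeratesZeros_sin :
    EnumeratesZeros Complex.sin univ fun j => (j : ℂ) * Real.pi := by
  refine ⟨Complex.differentiable_sin, fun a => ?_⟩
  have hsin := Complex.differentiable_sin.analyticAt a
  by_cases ha : Complex.sin a = 0
  · have hcos : deriv Complex.sin a ≠ 0 := fun h => by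
      rw [Complex.deriv_sin] at h
      simpa [ha, h] using Complex.sin_sq_add_cos_sq a
    obtain ⟨j, rfl⟩ := Complex.sin_eq_zero_iff.1 ha
    rw [hsin.analyticOrderAt_eq_one_of_zero_deriv_ne_zero ha hcos, encard_eq_one]
    exact ⟨j, by ext i; simp⟩
  · rw [hsin.analyticOrderAt_eq_zero.2 ha, encard_eq_zero]
    exact eq_empty_of_forall_notMem fun j hj => ha (hj.2 ▸ Complex.sin_int_mul_pi j)

lemma two_le_norm_sub_int_mul_pi {z : ℂ} {i j : ℤ} (hij : i ≠ j) (hz : ‖z - j * Real.pi‖ ≤ 1) :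
    2 ≤ ‖z - i * Real.pi‖ := by
  have htri : ‖((i - j : ℤ) : ℂ) * Real.pi‖ ≤ ‖z - j * Real.pi‖ + ‖z - i * Real.pi‖ := by
    refine le_of_eq_of_le (congrArg norm ?_) (norm_sub_le _ _)
    push_cast
    ring
  have hone : (1 : ℝ) ≤ |((i - j : ℤ) : ℝ)| := by
    exact_mod_cast Int.one_le_abs (sub_ne_zero.2 hij)
  rw [norm_int_mul_pi] at htri
  nlinarith [Real.pi_gt_three]

lemma one_le_norm_sub_of_norm_eq {z : ℂ} {N : ℕ} (hz : ‖z‖ = (N + 1 / 2) * Real.pi) (j : ℤ) :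
    1 ≤ ‖z - j * Real.pi‖ := by
  have htri := abs_norm_sub_norm_le z (j * Real.pi)
  rw [hz, norm_int_mul_pi, ← sub_mul, abs_mul, abs_of_pos Real.pi_pos,
    ← Int.cast_abs, Int.abs_eq_natAbs, Int.cast_natCast] at htri
  have hhalf : (1 : ℝ) / 2 ≤ |N + 1 / 2 - (j.natAbs : ℝ)| := by
    rcases le_or_gt j.natAbs N with h | h
    · have : (j.natAbs : ℝ) ≤ N := by exact_mod_cast h
      exact le_abs.2 (Or.inl (by linarith))
    · have : (N : ℝ) + 1 ≤ j.natAbs := by exact_mod_cast h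
      exact le_abs.2 (Or.inr (by linarith))
  nlinarith [Real.pi_gt_three]

/-- Centres of the discs used to locate the zeros of an entire function close to the sine: one disc
about `0` for the multiples `j * π` with `|j| ≤ N`, and one disc about every other `j * π`. -/
noncomputable def sineCenter (N : ℕ) (k : Option {j : ℤ // N < |j|}) : ℂ :=
  k.elim 0 fun j => (j : ℤ) * Real.pi

/-- Radii of the discs used to locate the zeros of an entire function close to the sine. -/
noncomputable def sineRadius (N : ℕ) (k : Option {j : ℤ // N < |j|}) : ℝ :=
  k.elim ((N + 1 / 2) * Real.pi) fun _ => 1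

lemma norm_ge_of_norm_sub_int_mul_pi_le {z : ℂ} {j : ℤ} (hz : ‖z - j * Real.pi‖ ≤ 1) :
    |(j : ℝ)| * Real.pi - 1 ≤ ‖z‖ := by
  have := norm_sub_norm_le (j * Real.pi : ℂ) z
  rw [norm_int_mul_pi, norm_sub_rev] at this
  linarith

lemma lt_norm_of_lt_abs {N : ℕ} {z : ℂ} {j : ℤ} (hj : N < |j|)
    (hz : ‖z - j * Real.pi‖ ≤ 1) : (N + 1 / 2) * Real.pi < ‖z‖ := by
  have hj' : (N : ℝ) + 1 ≤ |(j : ℝ)| := by exact_mod_cast hj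
  nlinarith [norm_ge_of_norm_sub_int_mul_pi_le hz, Real.pi_gt_three]

lemma pairwise_disjoint_closedBall_sineCenter (N : ℕ) :
    Pairwise (Function.onFun Disjoint fun k => closedBall (sineCenter N k) (sineRadius N k)) := by
  rintro (_ | ⟨i, hi⟩) (_ | ⟨j, hj⟩) hne <;> refine disjoint_left.2 fun z hz hz' => ?_
  · exact hne rfl
  · exact (lt_norm_of_lt_abs hj (mem_closedBall_iff_norm.1 hz')).not_ge
      (mem_closedBall_zero_iff.1 hz)
  · exact (lt_norm_of_lt_abs hi (mem_closedBall_iff_norm.1 hz)).not_ge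
      (mem_closedBall_zero_iff.1 hz')
  · have hij : i ≠ j := fun h => hne (by simp [h])
    have := two_le_norm_sub_int_mul_pi hij (mem_closedBall_iff_norm.1 hz')
    have : ‖z - i * Real.pi‖ ≤ 1 := mem_closedBall_iff_norm.1 hz
    linarith

lemma one_le_norm_sub_of_mem_sphere_sineCenter {N : ℕ} {k : Option {j : ℤ // N < |j|}} {z : ℂ}
    (hz : z ∈ sphere (sineCenter N k) (sineRadius N k)) :
    N ≤ ‖z‖ ∧ ∀ j : ℤ, 1 ≤ ‖z - j * Real.pi‖ := by
  rcases k with _ | ⟨i, hi⟩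
  · have hz' : ‖z‖ = (N + 1 / 2) * Real.pi := by simpa [sineCenter, sineRadius] using hz
    exact ⟨by rw [hz']; nlinarith [Real.pi_gt_three, Nat.cast_nonneg (α := ℝ) N],
      one_le_norm_sub_of_norm_eq hz'⟩
  · have hz' : ‖z - i * Real.pi‖ = 1 := mem_sphere_iff_norm.1 hz
    refine ⟨?_, fun j => ?_⟩
    · nlinarith [lt_norm_of_lt_abs hi hz'.le, Real.pi_gt_three, Nat.cast_nonneg (α := ℝ) N]
    · rcases eq_or_ne j i with rfl | hji
      · exact hz'.ge
      · exact one_le_two.trans (two_le_norm_sub_int_mul_pi hji hz'.le)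

lemma exists_mem_closedBall_sineCenter {N : ℕ} {z : ℂ}
    (hz : ‖z‖ ≤ N ∨ ∃ j : ℤ, ‖z - j * Real.pi‖ ≤ 1) :
    ∃ k, z ∈ closedBall (sineCenter N k) (sineRadius N k) := by
  by_cases hN : ‖z‖ ≤ (N + 1 / 2) * Real.pi
  · exact ⟨none, by simpa [sineCenter, sineRadius] using hN⟩
  · obtain ⟨j, hj⟩ := hz.resolve_left fun h =>
      hN (by nlinarith [Real.pi_gt_three, Nat.cast_nonneg (α := ℝ) N])
    refine ⟨some ⟨j, ?_⟩, mem_closedBall_iff_norm.2 hj⟩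
    have hpi : (N + 1 / 2 : ℝ) * Real.pi < |(j : ℝ)| * Real.pi + 1 := by
      have := norm_le_norm_add_norm_sub' z (j * Real.pi)
      rw [norm_int_mul_pi] at this
      linarith
    have hlt : (N : ℝ) < |(j : ℝ)| := by
      by_contra! h
      nlinarith [Real.pi_gt_three]
    exact_mod_cast hlt

variable {F : ℂ → ℂ}

theorem exists_enumeratesZeros_of_norm_sub_sin_lt (hF : Differentiable ℂ F)
    (hsin : ∀ᶠ w in cobounded ℂ, ‖F w - Complex.sin w‖ < Real.exp |w.im| / 6) :
    ∃ z, EnumeratesZeros F univ z ∧ ∀ᶠ j : ℤ in cofinite, ‖z j - j * Real.pi‖ ≤ 1 := by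
  obtain ⟨R, -, hR⟩ := (hasBasis_cobounded_norm (E := ℂ)).eventually_iff.1 hsin
  obtain ⟨N, hN⟩ := exists_nat_ge R
  have hlt : ∀ a : ℂ, N ≤ ‖a‖ → (∀ j : ℤ, 1 ≤ ‖a - j * Real.pi‖) →
      ‖F a - Complex.sin a‖ < ‖Complex.sin a‖ := fun a ha hj => by
    have := le_norm_sin le_rfl hj
    linarith [hR (show R ≤ ‖a‖ from hN.trans ha)]
  obtain ⟨z, hz, hzk⟩ := enumeratesZeros_sin.exists_of_norm_sub_lt hF
    (c := sineCenter N) (R := sineRadius N)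
    (by rintro (_ | k) <;> simp only [sineRadius, Option.elim] <;> positivity)
    (pairwise_disjoint_closedBall_sineCenter N)
    (fun a ha => exists_mem_closedBall_sineCenter <| by
      by_contra! h
      simpa [ha] using hlt a h.1.le fun j => (h.2 j).le)
    (fun j => exists_mem_closedBall_sineCenter (Or.inr ⟨j, by simp⟩))
    (fun k a ha => (one_le_norm_sub_of_mem_sphere_sineCenter ha).elim (hlt a))
  refine ⟨z, hz, (Icc (-N : ℤ) N).toFinite.subset fun j hj => ?_⟩
  rw [mem_Icc, ← abs_le]
  by_contra! hNj
  exact hj (mem_closedBall_iff_norm.1 (hzk j (some ⟨j, hNj⟩) (by simp [sineCenter, sineRadius])))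

lemma isBigO_sub_int_mul_pi {z : ℤ → ℂ} (hz : ∀ j, F (z j) = 0)
    (hzj : ∀ᶠ j : ℤ in cofinite, ‖z j - j * Real.pi‖ ≤ 1)
    (hsin : (fun w => F w - Complex.sin w) =O[cobounded ℂ] fun w => Real.exp |w.im| / ‖w‖) :
    (fun j : ℤ => z j - j * Real.pi) =O[cofinite] fun j => (j : ℝ)⁻¹ := by
  have hge : ∀ᶠ j : ℤ in cofinite, |(j : ℝ)| ≤ ‖z j‖ := by
    filter_upwards [hzj, (finite_singleton 0).compl_mem_cofinite] with j hj hj0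
    have : (1 : ℝ) ≤ |(j : ℝ)| := by exact_mod_cast Int.one_le_abs hj0
    nlinarith [norm_ge_of_norm_sub_int_mul_pi_le hj, Real.pi_gt_three]
  have htend : Tendsto z cofinite (cobounded ℂ) := by
    rw [← tendsto_norm_atTop_iff_cobounded]
    exact tendsto_atTop_mono' _ hge (tendsto_norm_cocompact_atTop.comp Int.tendsto_coe_cofinite)
  obtain ⟨C, hC0, hC⟩ := hsin.exists_pos
  refine IsBigO.of_bound (6 * C) ?_
  filter_upwards [hzj, hge, htend.eventually hC.bound, (finite_singleton 0).compl_mem_cofinite]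
    with j hj hjz hCj hj0
  have hlow := le_norm_sin hj fun i => by
    rcases eq_or_ne i j with rfl | hij
    · exact le_rfl
    · exact hj.trans (one_le_two.trans (two_le_norm_sub_int_mul_pi hij hj))
  rw [hz, zero_sub, norm_neg, Real.norm_of_nonneg (by positivity)] at hCj
  have hj : 0 < |(j : ℝ)| := abs_pos.2 (Int.cast_ne_zero.2 hj0)
  have hsmall : ‖z j - j * Real.pi‖ / 6 ≤ C / ‖z j‖ :=
    le_of_mul_le_mul_right ((hlow.trans hCj).trans_eq (by ring)) (Real.exp_pos _)
  calc ‖z j - j * Real.pi‖ ≤ 6 * (C / ‖z j‖) := by linarith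
    _ ≤ 6 * (C / |(j : ℝ)|) := by gcongr
    _ = 6 * C * ‖(j : ℝ)⁻¹‖ := by rw [norm_inv, Real.norm_eq_abs]; ring

theorem exists_enumeratesZeros_of_isBigO_sub_sin (hF : Differentiable ℂ F)
    (hsin : (fun w => F w - Complex.sin w) =O[cobounded ℂ] fun w => Real.exp |w.im| / ‖w‖) :
    ∃ z, EnumeratesZeros F univ z ∧
      (fun j : ℤ => z j - j * Real.pi) =O[cofinite] fun j => (j : ℝ)⁻¹ := by
  have hlt : ∀ᶠ w in cobounded ℂ, ‖F w - Complex.sin w‖ < Real.exp |w.im| / 6 := by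
    obtain ⟨C, hC0, hC⟩ := hsin.exists_pos
    filter_upwards [hC.bound, eventually_cobounded_le_norm (6 * C + 1)] with w hw hCw
    refine hw.trans_lt ?_
    rw [Real.norm_of_nonneg (by positivity), mul_div_assoc',
      div_lt_div_iff₀ (by linarith) (by norm_num)]
    nlinarith [Real.exp_pos |w.im|]
  obtain ⟨z, hz, hzj⟩ := exists_enumeratesZeros_of_norm_sub_sin_lt hF hlt
  exact ⟨z, hz, isBigO_sub_int_mul_pi hz.apply_eq_zero hzj hsin⟩

end Sine

section Rescaling

variable {f : ℂ → ℂ} {w : ℤ → ℂ} {a b : ℂ}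

namespace EnumeratesZeros

lemma of_const_mul {J : Set ℤ} (ha : a ≠ 0) (h : EnumeratesZeros (fun k => a * f k) J w) :
    EnumeratesZeros f J w := by
  have hf : Differentiable ℂ f := by simpa [ha] using h.1.const_mul a⁻¹
  refine ⟨hf, fun v => ?_⟩
  rw [h.2 v]
  change analyticOrderAt ((fun _ => a) * f) v = _
  rw [analyticOrderAt_mul analyticAt_const (hf.analyticAt v),
    analyticAt_const.analyticOrderAt_eq_zero.2 ha, zero_add]

lemma of_comp_affine (hf : Differentiable ℂ f) (ha : a ≠ 0)
    (h : EnumeratesZeros (fun k => f (a * k + b)) univ w) :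
    EnumeratesZeros f univ fun j => a * w j + b := by
  refine ⟨hf, fun v => ?_⟩
  have hv : a * ((v - b) / a) + b = v := by field_simp; ring
  have hderiv : HasDerivAt (fun k => a * k + b) a ((v - b) / a) := by
    simpa using ((hasDerivAt_id ((v - b) / a)).const_mul a).add_const b
  have hord := analyticOrderAt_comp_of_deriv_ne_zero (f := f) (g := fun k => a * k + b)
    (z₀ := (v - b) / a) (by fun_prop) (by rwa [hderiv.deriv])
  rw [hv] at hord
  rw [← hord]
  refine Eq.trans ?_ (h.2 _)
  congr 1
  ext j
  simp [eq_div_iff ha, eq_sub_iff_add_eq, mul_comm (w j)]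

lemma exists_of_sub_mul (hf : Differentiable ℂ f)
    (h : EnumeratesZeros (fun k => (k - a) * f k) univ w) (j₀ : ℤ) :
    ∃ z, EnumeratesZeros f {j | j ≠ j₀} z ∧ z =ᶠ[cofinite] w := by
  have hord : ∀ v, {j | w j = v}.encard
      = (({a} : Multiset ℂ).count v : ℕ∞) + analyticOrderAt f v := fun v => by
    rw [← analyticOrderAt_sub_const, h.encard_fiber]
    exact analyticOrderAt_mul (by fun_prop) (hf.analyticAt v)
  obtain ⟨i, hi⟩ : {j | w j = a}.Nonempty := by
    rw [← encard_ne_zero, hord]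
    simp
  set z : ℤ → ℂ := w ∘ Equiv.swap i j₀ with hz
  have hzj₀ : z j₀ = a := by simpa [hz] using hi
  have hfib : ∀ v, {j | z j = v}.encard = {j | w j = v}.encard := fun v =>
    encard_preimage_of_bijective (Equiv.swap i j₀).bijective {j | w j = v}
  have hj₀ : ∀ v, {j | j = j₀ ∧ z j = v}.encard = ({a} : Multiset ℂ).count v := fun v => by
    rw [Multiset.count_singleton]
    split_ifs with hv
    · exact_mod_cast encard_eq_one.2 ⟨j₀, by ext j; simpa [hv] using fun h => h ▸ hzj₀⟩
    · rw [Nat.cast_zero, encard_eq_zero]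
      exact eq_empty_of_forall_notMem fun j hj => hv (by rw [← hj.2, hj.1, hzj₀])
  refine ⟨z, ⟨hf, fun v => ?_⟩, ?_⟩
  · have hsplit : {j | z j = v} = {j | j = j₀ ∧ z j = v} ∪ {j | j ≠ j₀ ∧ z j = v} := by
      ext j
      simp [← or_and_right, em]
    have hcard := hfib v
    rw [hsplit, encard_union_eq (disjoint_left.2 fun j hj hj' => hj'.1 hj.1), hj₀, hord] at hcard
    exact ENat.add_right_injective_of_ne_top (ENat.natCast_ne_top _) hcard
  · filter_upwards [(toFinite {i, j₀}).compl_mem_cofinite] with j hj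
    simp only [mem_compl_iff, mem_insert_iff, mem_singleton_iff, not_or] at hj
    exact congrArg w (Equiv.swap_apply_of_ne_of_ne hj.1 hj.2)

end EnumeratesZeros

lemma isBigO_exp_abs_im_div_norm_comp_affine {B : ℝ} (hB : 0 < B) (δ : ℂ) :
    (fun w : ℂ => Real.exp (|((w - δ) / B).im| * B) / ‖(w - δ) / B‖) =O[cobounded ℂ]
      fun w => Real.exp |w.im| / ‖w‖ := by
  refine IsBigO.of_bound (2 * B * Real.exp |δ.im|) ?_
  filter_upwards [eventually_cobounded_le_norm (2 * ‖δ‖ + 1)] with w hw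
  have hw0 : 0 < ‖w‖ := by linarith [norm_nonneg δ]
  have hnorm : ‖w‖ / 2 ≤ ‖w - δ‖ := by linarith [norm_sub_norm_le w δ]
  have him : |((w - δ) / B).im| * B ≤ |δ.im| + |w.im| := by
    rw [Complex.div_ofReal_im, abs_div, abs_of_pos hB, div_mul_cancel₀ _ hB.ne', Complex.sub_im,
      add_comm]
    exact abs_sub _ _
  rw [Real.norm_of_nonneg (by positivity), Real.norm_of_nonneg (by positivity), norm_div,
    Complex.norm_real, Real.norm_of_nonneg hB.le]
  calc Real.exp (|((w - δ) / B).im| * B) / (‖w - δ‖ / B)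
      ≤ Real.exp (|δ.im| + |w.im|) / (‖w‖ / 2 / B) := by gcongr
    _ = 2 * B * Real.exp |δ.im| * (Real.exp |w.im| / ‖w‖) := by rw [Real.exp_add]; field_simp

theorem exists_enumeratesZeros_of_isBigO_sub_sin_affine {B : ℝ} {δ : ℂ} (hB : 0 < B)
    (hf : Differentiable ℂ f)
    (hsin : (fun k => f k - Complex.sin (B * k + δ)) =O[cobounded ℂ]
      fun k => Real.exp (|k.im| * B) / ‖k‖) :
    ∃ z, EnumeratesZeros f univ z ∧
      (fun j : ℤ => z j - (j * Real.pi - δ) / B) =O[cofinite] fun j => (j : ℝ)⁻¹ := by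
  have hB' : (B : ℂ) ≠ 0 := Complex.ofReal_ne_zero.2 hB.ne'
  set F : ℂ → ℂ := fun w => f ((B : ℂ)⁻¹ * w + -(δ / B)) with hF
  have hFd : Differentiable ℂ F := hf.comp (by fun_prop)
  have hbig : (fun w => F w - Complex.sin w) =O[cobounded ℂ] fun w => Real.exp |w.im| / ‖w‖ := by
    have hcob : Tendsto (fun w : ℂ => (w - δ) / B) (cobounded ℂ) (cobounded ℂ) := by
      simp only [div_eq_mul_inv]
      exact (tendsto_mul_right_cobounded (inv_ne_zero hB')).comp (tendsto_sub_const_cobounded δ)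
    refine ((hsin.comp_tendsto hcob).trans
      (isBigO_exp_abs_im_div_norm_comp_affine hB δ)).congr_left fun w => ?_
    simp only [hF, Function.comp_apply]
    congr 2 <;> field_simp <;> ring
  obtain ⟨w, hw, hwj⟩ := exists_enumeratesZeros_of_isBigO_sub_sin hFd hbig
  refine ⟨_, hw.of_comp_affine hf (inv_ne_zero hB'), ?_⟩
  refine (hwj.const_mul_left (B : ℂ)⁻¹).congr_left fun j => ?_
  ring

end Rescaling

section ParameterDependence

variable {ι E : Type*} {l : Filter ι} [NormedAddCommGroup E]

lemma tendstoUniformlyOn_iff_tendsto_norm_sub {α : Type*} {u : ι → α → E} {v : α → E} {s : Set α} :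
    TendstoUniformlyOn u v l s ↔
      Tendsto (fun q : ι × α => ‖u q.1 q.2 - v q.2‖) (l ×ˢ 𝓟 s) (𝓝 0) := by
  simp_rw [tendstoUniformlyOn_iff_tendsto, tendsto_uniformity_iff_dist_tendsto_zero,
    dist_eq_norm, norm_sub_rev]

lemma tendstoUniformlyOn_clm_apply {α 𝕜 F : Type*} [NontriviallyNormedField 𝕜] [NormedSpace 𝕜 E]
    [NormedAddCommGroup F] [NormedSpace 𝕜 F] {s : Set α} {A : ι → α → E →L[𝕜] F}
    {A₀ : α → E →L[𝕜] F} {u : ι → α → E} {u₀ : α → E} {M N : ℝ}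
    (hA : TendstoUniformlyOn A A₀ l s) (hu : TendstoUniformlyOn u u₀ l s)
    (hA₀ : ∀ r ∈ s, ‖A₀ r‖ ≤ M) (hu₀ : ∀ r ∈ s, ‖u₀ r‖ ≤ N) :
    TendstoUniformlyOn (fun i r => A i r (u i r)) (fun r => A₀ r (u₀ r)) l s := by
  rw [tendstoUniformlyOn_iff_tendsto_norm_sub] at hA hu ⊢
  have hlim := (hA.mul (hu.add_const N)).add (hu.const_mul M)
  rw [zero_mul, mul_zero, zero_add] at hlim
  refine squeeze_zero' (Eventually.of_forall fun _ => norm_nonneg _) ?_ hlim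
  filter_upwards [prod_mem_prod univ_mem (mem_principal_self s)] with q hq
  obtain ⟨i, r⟩ := q
  have hr : r ∈ s := hq.2
  have hsplit : A i r (u i r) - A₀ r (u₀ r)
      = (A i r - A₀ r) (u i r) + A₀ r (u i r - u₀ r) := by simp
  have hnorm : ‖u i r‖ ≤ ‖u i r - u₀ r‖ + N :=
    (norm_le_norm_sub_add _ _).trans (by gcongr; exact hu₀ r hr)
  rw [hsplit]
  refine (norm_add_le _ _).trans (add_le_add ?_ ?_)
  · exact ((A i r - A₀ r).le_opNorm _).trans (by gcongr)
  · exact ((A₀ r).le_opNorm _).trans (by gcongr; exact hA₀ r hr)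

lemma norm_le_gronwallBound_of_hasDerivWithinAt_Icc [NormedSpace ℝ E] {u u' : ℝ → E}
    {a b K η : ℝ} (hK : 0 ≤ K) (hη : 0 ≤ η)
    (hu : ∀ r ∈ Icc a b, HasDerivWithinAt u (u' r) (Icc a b) r) (hua : u a = 0)
    (hu' : ∀ r ∈ Icc a b, ‖u' r‖ ≤ K * ‖u r‖ + η) :
    ∀ r ∈ Icc a b, ‖u r‖ ≤ gronwallBound 0 K η (b - a) := fun r hr => by
  have h := norm_le_gronwallBound_of_norm_deriv_right_le
    (fun r hr => (hu r hr).continuousWithinAt)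
    (fun r hr => (hu r (Ico_subset_Icc_self hr)).mono_of_mem_nhdsWithin (Icc_mem_nhdsGE_of_mem hr))
    (norm_le_zero_iff.2 hua) (fun r hr => hu' r (Ico_subset_Icc_self hr)) r hr
  exact h.trans (gronwallBound_mono le_rfl hη hK (sub_le_sub_right hr.2 a))

lemma tendstoUniformlyOn_zero_of_norm_deriv_le [NormedSpace ℝ E] {F : Type*}
    [NormedAddCommGroup F] {u u' : ι → ℝ → E} {g : ι → ℝ → F} {a b K : ℝ}
    (hu : ∀ i, ∀ r ∈ Icc a b, HasDerivWithinAt (u i) (u' i r) (Icc a b) r)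
    (hua : ∀ i, u i a = 0)
    (hu' : ∀ᶠ i in l, ∀ r ∈ Icc a b, ‖u' i r‖ ≤ K * ‖u i r‖ + ‖g i r‖)
    (hg : TendstoUniformlyOn g 0 l (Icc a b)) : TendstoUniformlyOn u 0 l (Icc a b) := by
  rw [Metric.tendstoUniformlyOn_iff] at hg ⊢
  intro δ hδ
  have hlim : Tendsto (fun η => gronwallBound 0 |K| η (b - a)) (𝓝[>] 0) (𝓝 0) := by
    have := (gronwallBound_continuous_ε 0 |K| (b - a)).tendsto 0
    rw [gronwallBound_ε0_δ0] at this
    exact this.mono_left nhdsWithin_le_nhds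
  obtain ⟨η, hηδ, hη⟩ := ((hlim.eventually_lt_const hδ).and self_mem_nhdsWithin).exists
  filter_upwards [hu', hg η hη] with i hi hgi r hr
  rw [Pi.zero_apply, dist_zero_left]
  refine (norm_le_gronwallBound_of_hasDerivWithinAt_Icc (abs_nonneg K) (le_of_lt hη) (hu i) (hua i)
    (fun s hs => (hi s hs).trans ?_) r hr).trans_lt hηδ
  gcongr
  · exact le_abs_self K
  · simpa using (hgi s hs).le

lemma tendstoUniformlyOn_of_slope {α 𝕜 F : Type*} [NontriviallyNormedField 𝕜] [NormedAddCommGroup F]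
    [NormedSpace 𝕜 F] {A : 𝕜 → α → F} {A' : α → F} {k₀ : 𝕜} {s : Set α} {M : ℝ}
    (hA : TendstoUniformlyOn (fun k r => slope (fun k => A k r) k₀ k) A' (𝓝[≠] k₀) s)
    (hM : ∀ r ∈ s, ‖A' r‖ ≤ M) : TendstoUniformlyOn A (A k₀) (𝓝[≠] k₀) s := by
  have hk : Tendsto (fun q : 𝕜 × α => ‖q.1 - k₀‖) (𝓝[≠] k₀ ×ˢ 𝓟 s) (𝓝 0) :=
    (tendsto_iff_norm_sub_tendsto_zero.1 (tendsto_id'.2 nhdsWithin_le_nhds)).comp tendsto_fst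
  rw [tendstoUniformlyOn_iff_tendsto_norm_sub] at hA ⊢
  have hlim := hk.mul (hA.add_const M)
  rw [zero_mul] at hlim
  refine squeeze_zero' (Eventually.of_forall fun _ => norm_nonneg _) ?_ hlim
  filter_upwards [prod_mem_prod univ_mem (mem_principal_self s)] with q hq
  obtain ⟨k, r⟩ := q
  have hr : r ∈ s := hq.2
  have hslope : A k r - A k₀ r = (k - k₀) • slope (fun k => A k r) k₀ k := by
    simp only [sub_smul_slope, vsub_eq_sub]
  rw [hslope, norm_smul]
  gcongr
  exact (norm_le_norm_sub_add _ _).trans (by gcongr; exact hM r hr)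

variable [NormedSpace ℂ E] {x : ℂ → ℝ → E} {A : ℂ → ℝ → E →L[ℂ] E} {A' : ℝ → E →L[ℂ] E}
  {x₀ : E} {k₀ : ℂ} {a b K K' : ℝ}

lemma tendstoUniformlyOn_solution
    (hx : ∀ k, ∀ r ∈ Icc a b, HasDerivWithinAt (x k) (A k r (x k r)) (Icc a b) r)
    (hxa : ∀ k, x k a = x₀) {l : Filter ℂ} (hA : TendstoUniformlyOn A (A k₀) l (Icc a b))
    (hK : ∀ r ∈ Icc a b, ‖A k₀ r‖ ≤ K) :
    TendstoUniformlyOn x (x k₀) l (Icc a b) := by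
  obtain ⟨N, hN⟩ := isCompact_Icc.exists_bound_of_continuousOn
    (fun r hr => (hx k₀ r hr).continuousWithinAt)
  have hforce : TendstoUniformlyOn (fun k r => (A k r - A k₀ r) (x k₀ r)) 0 l (Icc a b) := by
    have hconst : TendstoUniformlyOn (fun _ : ℂ => x k₀) (x k₀) l (Icc a b) := by
      simp [tendstoUniformlyOn_iff_tendsto_norm_sub, tendsto_const_nhds]
    have := tendstoUniformlyOn_clm_apply hA hconst hK hN
    rw [tendstoUniformlyOn_iff_tendsto_norm_sub] at this ⊢
    simpa using this
  have hA1 : ∀ᶠ k in l, ∀ r ∈ Icc a b, ‖A k r - A k₀ r‖ ≤ 1 := by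
    filter_upwards [Metric.tendstoUniformlyOn_iff.1 hA 1 one_pos] with k hk r hr
    rw [← dist_eq_norm, dist_comm]
    exact (hk r hr).le
  have hdiff : TendstoUniformlyOn (fun k => x k - x k₀) 0 l (Icc a b) := by
    refine tendstoUniformlyOn_zero_of_norm_deriv_le (K := K + 1)
      (fun k r hr => (hx k r hr).sub (hx k₀ r hr)) (by simp [hxa]) ?_ hforce
    filter_upwards [hA1] with k hk r hr
    have hsplit : A k r (x k r) - A k₀ r (x k₀ r)
        = A k₀ r (x k r - x k₀ r) + (A k r - A k₀ r) (x k r - x k₀ r)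
          + (A k r - A k₀ r) (x k₀ r) := by
      simp
    rw [hsplit, add_mul]
    refine (norm_add_le _ _).trans (add_le_add_left ((norm_add_le _ _).trans (add_le_add ?_ ?_)) _)
    · exact ((A k₀ r).le_opNorm _).trans (mul_le_mul_of_nonneg_right (hK r hr) (norm_nonneg _))
    · exact ((A k r - A k₀ r).le_opNorm _).trans
        (mul_le_mul_of_nonneg_right (hk r hr) (norm_nonneg _))
  rw [tendstoUniformlyOn_iff_tendsto_norm_sub] at hdiff ⊢
  simpa using hdiff

theorem differentiableAt_solution [CompleteSpace E]
    (hx : ∀ k, ∀ r ∈ Icc a b, HasDerivWithinAt (x k) (A k r (x k r)) (Icc a b) r)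
    (hxa : ∀ k, x k a = x₀)
    (hA : TendstoUniformlyOn (fun k r => slope (fun k => A k r) k₀ k) A' (𝓝[≠] k₀) (Icc a b))
    (hK : ∀ r ∈ Icc a b, ‖A k₀ r‖ ≤ K) (hK' : ∀ r ∈ Icc a b, ‖A' r‖ ≤ K') {r : ℝ}
    (hr : r ∈ Icc a b) : DifferentiableAt ℂ (fun k => x k r) k₀ := by
  obtain ⟨N, hN⟩ := isCompact_Icc.exists_bound_of_continuousOn
    (fun r hr => (hx k₀ r hr).continuousWithinAt)
  set w : ℂ → ℝ → E := fun k r => slope (fun k => x k r) k₀ k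
  set g : ℂ → ℝ → E := fun k r => slope (fun k => A k r) k₀ k (x k r)
  have hw : ∀ k, ∀ r ∈ Icc a b,
      HasDerivWithinAt (w k) (A k₀ r (w k r) + g k r) (Icc a b) r := fun k r hr => by
    refine (((hx k r hr).sub (hx k₀ r hr)).const_smul (k - k₀)⁻¹).congr_deriv ?_
    simp [w, g, slope_def_module, ← smul_add]
  have hg : UniformCauchySeqOn g (𝓝[≠] k₀) (Icc a b) :=
    (tendstoUniformlyOn_clm_apply hA (tendstoUniformlyOn_solution hx hxa
      (tendstoUniformlyOn_of_slope hA hK') hK) hK' hN).uniformCauchySeqOn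
  have hcauchy : UniformCauchySeqOn w (𝓝[≠] k₀) (Icc a b) := by
    rw [SeminormedAddGroup.uniformCauchySeqOn_iff_tendstoUniformlyOn_zero] at hg ⊢
    refine tendstoUniformlyOn_zero_of_norm_deriv_le (K := K)
      (fun q r hr => (hw q.1 r hr).neg.add (hw q.2 r hr)) (by simp [w, slope_def_module, hxa])
      (Eventually.of_forall fun q r hr => ?_) hg
    have hsplit : -(A k₀ r (w q.1 r) + g q.1 r) + (A k₀ r (w q.2 r) + g q.2 r)
        = A k₀ r (-w q.1 r + w q.2 r) + (-g q.1 r + g q.2 r) := by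
      rw [map_add, map_neg]; abel
    rw [hsplit]
    refine (norm_add_le _ _).trans (add_le_add_left ?_ _)
    exact ((A k₀ r).le_opNorm _).trans (mul_le_mul_of_nonneg_right (hK r hr) (norm_nonneg _))
  obtain ⟨y, hy⟩ := cauchy_map_iff_exists_tendsto.1 (hcauchy.cauchy_map hr)
  exact (hasDerivAt_iff_tendsto_slope.2 hy).differentiableAt

end ParameterDependence

section EntireSolution

/-- The operator `(u, u') ↦ (0, u)`, the coefficient of `-V` in `companionOperator V`. -/
noncomputable def inrFst : ℂ × ℂ →L[ℂ] ℂ × ℂ :=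
  (0 : ℂ × ℂ →L[ℂ] ℂ).prod (.fst ℂ ℂ ℂ)

/-- The first order operator `(u, u') ↦ (u', -V u)` of the equation `u'' + V u = 0`. -/
noncomputable def companionOperator (V : ℂ) : ℂ × ℂ →L[ℂ] ℂ × ℂ :=
  (ContinuousLinearMap.snd ℂ ℂ ℂ).prod 0 - V • inrFst

lemma slope_companionOperator (V : ℂ → ℂ) (k₀ k : ℂ) :
    slope (fun k => companionOperator (V k)) k₀ k
      = -slope V k₀ k • inrFst := by
  simp only [companionOperator, slope_def_module, sub_sub_sub_cancel_left]
  rw [← sub_smul (V k₀) (V k) inrFst, smul_smul, smul_eq_mul, ← mul_neg, neg_sub]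

variable {ε γ : ℝ → ℝ}

lemma IsSolution.hasDerivWithinAt_prod {k : ℂ} {u u' : ℝ → ℂ} (h : IsSolution ε γ k u u') {r : ℝ}
    (hr : r ∈ Icc (0 : ℝ) 1) :
    HasDerivWithinAt (fun r => (u r, u' r))
      (companionOperator (k ^ 2 * ε r + Complex.I * k * γ r) (u r, u' r)) (Icc 0 1) r := by
  refine ((h.hasDeriv r hr).prodMk (h.hasDeriv' r hr)).congr_deriv ?_
  simp [companionOperator, inrFst]

lemma tendstoUniformlyOn_slope_companionOperator (hε : ContinuousOn ε (Icc 0 1)) (k₀ : ℂ) :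
    TendstoUniformlyOn
      (fun k r => slope (fun k => companionOperator (k ^ 2 * ε r + Complex.I * k * γ r)) k₀ k)
      (fun r => -(2 * k₀ * ε r + Complex.I * γ r) • inrFst) (𝓝[≠] k₀) (Icc 0 1) := by
  obtain ⟨M, hM⟩ := isCompact_Icc.exists_bound_of_continuousOn hε
  have hlim : Tendsto (fun k => ‖k - k₀‖ * M * ‖inrFst‖) (𝓝[≠] k₀) (𝓝 0) := by
    have h : Tendsto (fun k => ‖k - k₀‖) (𝓝[≠] k₀) (𝓝 0) :=
      tendsto_iff_norm_sub_tendsto_zero.1 (tendsto_id'.2 nhdsWithin_le_nhds)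
    simpa using (h.mul_const M).mul_const ‖inrFst‖
  rw [Metric.tendstoUniformlyOn_iff]
  intro δ hδ
  filter_upwards [hlim.eventually_lt_const hδ, self_mem_nhdsWithin] with k hk hne r hr
  refine lt_of_le_of_lt ?_ hk
  have hslope : slope (fun k : ℂ => k ^ 2 * (ε r : ℂ) + Complex.I * k * γ r) k₀ k
      = (k + k₀) * ε r + Complex.I * γ r := by
    rw [slope_def_field, div_eq_iff (sub_ne_zero.2 hne)]
    ring
  have hdiff : -((k + k₀) * (ε r : ℂ) + Complex.I * γ r) • inrFst
      - -(2 * k₀ * (ε r : ℂ) + Complex.I * γ r) • inrFst = ((k₀ - k) * ε r) • inrFst := by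
    module
  rw [slope_companionOperator, hslope, dist_comm, dist_eq_norm, hdiff, norm_smul, norm_mul,
    norm_sub_rev, Complex.norm_real]
  gcongr
  exact hM r hr

variable {y y' : ℝ → ℂ → ℂ}

theorem differentiable_prod_of_isSolution (hε : ContinuousOn ε (Icc 0 1))
    (hγ : ContinuousOn γ (Icc 0 1))
    (hy : ∀ k : ℂ, IsSolution ε γ k (fun r => y r k) (fun r => y' r k)) {r : ℝ}
    (hr : r ∈ Icc (0 : ℝ) 1) : Differentiable ℂ fun k => (y r k, y' r k) := fun k₀ => by
  obtain ⟨K, hK⟩ := isCompact_Icc.exists_bound_of_continuousOn (s := Icc (0 : ℝ) 1)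
    (f := fun r => companionOperator (k₀ ^ 2 * ε r + Complex.I * k₀ * γ r))
    (by unfold companionOperator; fun_prop)
  obtain ⟨K', hK'⟩ := isCompact_Icc.exists_bound_of_continuousOn (s := Icc (0 : ℝ) 1)
    (f := fun r => -(2 * k₀ * ε r + Complex.I * γ r) • inrFst)
    (by fun_prop)
  exact differentiableAt_solution (x := fun k r => (y r k, y' r k)) (x₀ := (0, 1))
    (fun k _ => (hy k).hasDerivWithinAt_prod) (fun k => Prod.ext (hy k).init (hy k).init')
    (tendstoUniformlyOn_slope_companionOperator hε k₀) hK hK' hr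

end EntireSolution

section WeaklyCoupledSystems

variable {S : ℝ → ℝ} {a b c : ℝ}

lemma norm_sub_cexp_mul_le {x v Θ Θ' : ℝ → ℂ} {η : ℝ}
    (hx : ∀ r ∈ Icc a b, HasDerivWithinAt x (Θ' r * x r + v r) (Icc a b) r)
    (hΘ : ∀ r ∈ Icc a b, HasDerivWithinAt Θ (Θ' r) (Icc a b) r)
    (hre : ∀ r ∈ Icc a b, ∀ s ∈ Icc a r, (Θ r - Θ s).re ≤ c + (S r - S s))
    (hv : ∀ r ∈ Icc a b, ‖v r‖ ≤ η * Real.exp (S r)) {r : ℝ} (hr : r ∈ Icc a b) :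
    ‖x r - Complex.exp (Θ r - Θ a) * x a‖ ≤ Real.exp c * η * Real.exp (S r) * (r - a) := by
  have hsub : Icc a r ⊆ Icc a b := Icc_subset_Icc_right hr.2
  have hderiv : ∀ s ∈ Icc a r, HasDerivWithinAt (fun s => Complex.exp (Θ r - Θ s) * x s)
      (Complex.exp (Θ r - Θ s) * v s) (Icc a r) s := fun s hs => by
    refine ((((hΘ s (hsub hs)).const_sub (Θ r)).cexp.mul (hx s (hsub hs))).mono hsub).congr_deriv ?_
    ring
  have hbound : ∀ s ∈ Ico a r,
      ‖Complex.exp (Θ r - Θ s) * v s‖ ≤ Real.exp c * η * Real.exp (S r) := fun s hs => by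
    have hs' : s ∈ Icc a r := Ico_subset_Icc_self hs
    calc ‖Complex.exp (Θ r - Θ s) * v s‖
        ≤ Real.exp (c + (S r - S s)) * (η * Real.exp (S s)) := by
          rw [norm_mul, Complex.norm_exp]
          gcongr
          exacts [hre r hr s hs', hv s (hsub hs')]
      _ = Real.exp c * η * Real.exp (S r) := by
          rw [Real.exp_add, Real.exp_sub]
          field_simp
  simpa using norm_image_sub_le_of_norm_deriv_le_segment' hderiv hbound r ⟨hr.1, le_rfl⟩

lemma exists_norm_le_mul_exp {E : Type*} [SeminormedAddCommGroup E] {x : ℝ → E}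
    (hab : (Icc a b).Nonempty) (hx : ContinuousOn x (Icc a b)) (hS : ContinuousOn S (Icc a b)) :
    ∃ r₀ ∈ Icc a b, ∀ r ∈ Icc a b, ‖x r‖ ≤ ‖x r₀‖ * Real.exp (S r - S r₀) := by
  obtain ⟨r₀, hr₀, hmax⟩ := isCompact_Icc.exists_isMaxOn hab (hS.neg.rexp.mul hx.norm)
  refine ⟨r₀, hr₀, fun r hr => ?_⟩
  have h : Real.exp (-S r) * ‖x r‖ ≤ Real.exp (-S r₀) * ‖x r₀‖ := hmax hr
  rw [Real.exp_neg, inv_mul_le_iff₀ (Real.exp_pos _)] at h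
  rw [sub_eq_add_neg, Real.exp_add]
  linarith

variable {ι : Type*} [Fintype ι] {x v : ℝ → ι → ℂ} {Θ Θ' : ι → ℝ → ℂ} {κ : ℝ}

theorem norm_le_of_weaklyCoupled
    (hx : ∀ i, ∀ r ∈ Icc a b,
      HasDerivWithinAt (fun r => x r i) (Θ' i r * x r i + v r i) (Icc a b) r)
    (hΘ : ∀ i, ∀ r ∈ Icc a b, HasDerivWithinAt (Θ i) (Θ' i r) (Icc a b) r)
    (hS : ContinuousOn S (Icc a b))
    (hre : ∀ i, ∀ r ∈ Icc a b, ∀ s ∈ Icc a r, (Θ i r - Θ i s).re ≤ c + (S r - S s))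
    (hv : ∀ i, ∀ r ∈ Icc a b, ‖v r i‖ ≤ κ * ‖x r‖) (hκ : 0 ≤ κ)
    (hκc : 2 * Real.exp c * κ * (b - a) ≤ 1) {r : ℝ} (hr : r ∈ Icc a b) :
    ‖x r‖ ≤ 2 * Real.exp c * ‖x a‖ * Real.exp (S r - S a) := by
  obtain ⟨r₀, hr₀, hmax⟩ := exists_norm_le_mul_exp ⟨r, hr⟩
    (continuousOn_pi.2 fun i r hr => (hx i r hr).continuousWithinAt) hS
  have hfree : ∀ i, ‖Complex.exp (Θ i r₀ - Θ i a) * x a i‖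
      ≤ Real.exp (c + (S r₀ - S a)) * ‖x a‖ := fun i => by
    rw [norm_mul, Complex.norm_exp]
    gcongr
    exacts [hre i r₀ hr₀ a ⟨le_rfl, hr₀.1⟩, norm_le_pi_norm (x a) i]
  have hforce : ∀ i, ∀ r ∈ Icc a b,
      ‖v r i‖ ≤ κ * (‖x r₀‖ * Real.exp (-S r₀)) * Real.exp (S r) := fun i r hr => by
    refine (hv i r hr).trans ((mul_le_mul_of_nonneg_left (hmax r hr) hκ).trans_eq ?_)
    rw [sub_eq_neg_add, Real.exp_add]
    ring
  -- The forcing contributes at most half of the largest value of `exp (-S) * ‖x‖`.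
  have hforced : ∀ i, ‖x r₀ i - Complex.exp (Θ i r₀ - Θ i a) * x a i‖ ≤ ‖x r₀‖ / 2 := fun i => by
    calc _ ≤ Real.exp c * (κ * (‖x r₀‖ * Real.exp (-S r₀))) * Real.exp (S r₀) * (r₀ - a) :=
          norm_sub_cexp_mul_le (hx i) (hΘ i) (hre i) (hforce i) hr₀
      _ = Real.exp c * κ * ‖x r₀‖ * (r₀ - a) := by rw [Real.exp_neg]; field_simp
      _ ≤ Real.exp c * κ * ‖x r₀‖ * (b - a) := by gcongr; exact hr₀.2
      _ = 2 * Real.exp c * κ * (b - a) * (‖x r₀‖ / 2) := by ring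
      _ ≤ ‖x r₀‖ / 2 := mul_le_of_le_one_left (by positivity) hκc
  have habsorb : ‖x r₀‖ ≤ Real.exp (c + (S r₀ - S a)) * ‖x a‖ + ‖x r₀‖ / 2 :=
    (pi_norm_le_iff_of_nonneg (by positivity)).2 fun i =>
      (norm_le_norm_add_norm_sub' _ _).trans (add_le_add (hfree i) (hforced i))
  calc ‖x r‖ ≤ ‖x r₀‖ * Real.exp (S r - S r₀) := hmax r hr
    _ ≤ 2 * (Real.exp (c + (S r₀ - S a)) * ‖x a‖) * Real.exp (S r - S r₀) := by
        gcongr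
        linarith
    _ = 2 * Real.exp c * ‖x a‖ * Real.exp (S r - S a) := by
        rw [← sub_add_sub_cancel (S r) (S r₀) (S a), Real.exp_add, Real.exp_add]
        ring

theorem norm_sub_cexp_mul_le_of_weaklyCoupled
    (hx : ∀ i, ∀ r ∈ Icc a b,
      HasDerivWithinAt (fun r => x r i) (Θ' i r * x r i + v r i) (Icc a b) r)
    (hΘ : ∀ i, ∀ r ∈ Icc a b, HasDerivWithinAt (Θ i) (Θ' i r) (Icc a b) r)
    (hS : ContinuousOn S (Icc a b))
    (hre : ∀ i, ∀ r ∈ Icc a b, ∀ s ∈ Icc a r, (Θ i r - Θ i s).re ≤ c + (S r - S s))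
    (hv : ∀ i, ∀ r ∈ Icc a b, ‖v r i‖ ≤ κ * ‖x r‖) (hκ : 0 ≤ κ)
    (hκc : 2 * Real.exp c * κ * (b - a) ≤ 1) {r : ℝ} (hr : r ∈ Icc a b) (i : ι) :
    ‖x r i - Complex.exp (Θ i r - Θ i a) * x a i‖
      ≤ 2 * Real.exp c ^ 2 * κ * ‖x a‖ * Real.exp (S r - S a) * (r - a) := by
  have hforce : ∀ r ∈ Icc a b,
      ‖v r i‖ ≤ κ * (2 * Real.exp c * ‖x a‖ * Real.exp (-S a)) * Real.exp (S r) := fun r hr => by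
    refine (hv i r hr).trans ((mul_le_mul_of_nonneg_left
      (norm_le_of_weaklyCoupled hx hΘ hS hre hv hκ hκc hr) hκ).trans_eq ?_)
    rw [sub_eq_neg_add, Real.exp_add]
    ring
  refine (norm_sub_cexp_mul_le (hx i) (hΘ i) (hre i) hforce hr).trans_eq ?_
  rw [sub_eq_neg_add (S r), Real.exp_add]
  ring

end WeaklyCoupledSystems

section LiouvilleGreen

/-- The damping rate `γ / (2 √ε)` of the waves. -/
noncomputable def damping (ε γ : ℝ → ℝ) (r : ℝ) : ℝ := γ r / (2 * √(ε r))

/-- The factor `ε ^ (-1/4)`; the Liouville–Green approximation is this times an exponential. -/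
noncomputable def amplitude (ε : ℝ → ℝ) (r : ℝ) : ℝ := ε r ^ (-(1 / 4) : ℝ)

/-- The logarithmic derivative `-ε' / (4 ε)` of `amplitude ε` on `[0, 1]`. -/
noncomputable def amplitudeLogDeriv (ε : ℝ → ℝ) (r : ℝ) : ℝ :=
  -derivWithin ε (Icc 0 1) r / (4 * ε r)

/-- The rate `i k √ε - γ / (2 √ε)` of the exponentials in the Liouville–Green approximation. -/
noncomputable def waveRate (ε γ : ℝ → ℝ) (k : ℂ) (r : ℝ) : ℂ :=
  Complex.I * k * √(ε r) - damping ε γ r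

/-- The primitive of `waveRate ε γ k` that vanishes at `0`. -/
noncomputable def wavePhase (ε γ : ℝ → ℝ) (k : ℂ) (r : ℝ) : ℂ :=
  Complex.I * k * (∫ t in (0 : ℝ)..r, √(ε t)) - (∫ t in (0 : ℝ)..r, damping ε γ t)

/-- For `s = ±1`, the combination `ε ^ (-1/4) (u' + (s φ - l) u)` of `u` and `u'`, where
`φ = waveRate ε γ k` and `l = amplitudeLogDeriv ε`; it nearly satisfies `x' = s φ x`. -/
noncomputable def waveComponent (ε γ : ℝ → ℝ) (k : ℂ) (u u' : ℝ → ℂ) (r : ℝ) (s : ℤˣ) : ℂ :=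
  amplitude ε r * (u' r + (((s : ℤ) : ℂ) * waveRate ε γ k r - amplitudeLogDeriv ε r) * u r)

/-- The factor `R` in the defect `R ε ^ (-1/4) u` of the equation `x' = s φ x` for
`x = waveComponent ε γ k u u' s`. -/
noncomputable def waveDefect (ε γ : ℝ → ℝ) (r : ℝ) (s : ℤˣ) : ℝ :=
  -(s : ℤ) * (derivWithin (damping ε γ) (Icc 0 1) r + 2 * amplitudeLogDeriv ε r * damping ε γ r)
    - damping ε γ r ^ 2 - derivWithin (amplitudeLogDeriv ε) (Icc 0 1) r - amplitudeLogDeriv ε r ^ 2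

lemma hasDerivWithinAt_mul_add_mul {u u' a l φ : ℝ → ℂ} {V l' φ' : ℂ} {s : Set ℝ} {r : ℝ}
    (hu : HasDerivWithinAt u (u' r) s r) (hu' : HasDerivWithinAt u' (-(V * u r)) s r)
    (ha : HasDerivWithinAt a (l r * a r) s r) (hl : HasDerivWithinAt l l' s r)
    (hφ : HasDerivWithinAt φ φ' s r) :
    HasDerivWithinAt (fun r => a r * (u' r + (φ r - l r) * u r))
      (φ r * (a r * (u' r + (φ r - l r) * u r))
        + (φ' + 2 * l r * φ r - φ r ^ 2 - V - l' - l r ^ 2) * (a r * u r)) s r := by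
  refine (ha.mul (hu'.add ((hφ.sub hl).mul hu))).congr_deriv ?_
  simp only [Pi.add_apply, Pi.sub_apply, Pi.mul_apply]
  ring

lemma hasDerivWithinAt_integral_Icc {f : ℝ → ℝ} {a b r : ℝ} (hf : ContinuousOn f (Icc a b))
    (hr : r ∈ Icc a b) : HasDerivWithinAt (fun x => ∫ t in a..x, f t) (f r) (Icc a b) r := by
  have : Fact (r ∈ Icc a b) := ⟨hr⟩
  refine intervalIntegral.integral_hasDerivWithinAt_right ?_
    (hf.stronglyMeasurableAtFilter_nhdsWithin measurableSet_Icc r) (hf r hr)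
  refine (hf.mono ?_).intervalIntegrable
  rw [uIcc_of_le hr.1]
  exact Icc_subset_Icc_right hr.2

variable {ε γ : ℝ → ℝ}

lemma contDiffOn_damping (hε : ContDiffOn ℝ 1 ε (Icc 0 1)) (hγ : ContDiffOn ℝ 1 γ (Icc 0 1))
    (hpos : ∀ r ∈ Icc (0 : ℝ) 1, 0 < ε r) : ContDiffOn ℝ 1 (damping ε γ) (Icc 0 1) :=
  hγ.div (contDiffOn_const.mul (hε.sqrt fun r hr => (hpos r hr).ne')) fun r hr =>
    mul_ne_zero two_ne_zero (Real.sqrt_pos.2 (hpos r hr)).ne'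

lemma contDiffOn_amplitudeLogDeriv (hε : ContDiffOn ℝ 2 ε (Icc 0 1))
    (hpos : ∀ r ∈ Icc (0 : ℝ) 1, 0 < ε r) : ContDiffOn ℝ 1 (amplitudeLogDeriv ε) (Icc 0 1) :=
  (hε.derivWithin (uniqueDiffOn_Icc zero_lt_one) (by norm_num)).neg.div
    (contDiffOn_const.mul (hε.of_le (by norm_num))) fun r hr =>
      mul_ne_zero four_ne_zero (hpos r hr).ne'

lemma continuousOn_waveDefect (hε : ContDiffOn ℝ 2 ε (Icc 0 1))
    (hγ : ContDiffOn ℝ 1 γ (Icc 0 1)) (hpos : ∀ r ∈ Icc (0 : ℝ) 1, 0 < ε r) (s : ℤˣ) :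
    ContinuousOn (fun r => waveDefect ε γ r s) (Icc 0 1) := by
  have hud : UniqueDiffOn ℝ (Icc (0 : ℝ) 1) := uniqueDiffOn_Icc zero_lt_one
  have hp := contDiffOn_damping (hε.of_le one_le_two) hγ hpos
  have hl := contDiffOn_amplitudeLogDeriv hε hpos
  have hpc := hp.continuousOn
  have hlc := hl.continuousOn
  have hp' := hp.continuousOn_derivWithin hud le_rfl
  have hl' := hl.continuousOn_derivWithin hud le_rfl
  unfold waveDefect
  fun_prop

section Derivatives

variable {r : ℝ}

lemma hasDerivWithinAt_amplitude (hε : DifferentiableWithinAt ℝ ε (Icc 0 1) r) (hpos : 0 < ε r) :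
    HasDerivWithinAt (amplitude ε) (amplitudeLogDeriv ε r * amplitude ε r) (Icc 0 1) r := by
  refine (hε.hasDerivWithinAt.rpow_const (Or.inl hpos.ne')).congr_deriv ?_
  rw [amplitudeLogDeriv, amplitude, Real.rpow_sub_one hpos.ne']
  field_simp

lemma hasDerivWithinAt_sqrt (hε : DifferentiableWithinAt ℝ ε (Icc 0 1) r) (hpos : 0 < ε r) :
    HasDerivWithinAt (fun r => √(ε r)) (-2 * amplitudeLogDeriv ε r * √(ε r)) (Icc 0 1) r := by
  refine (hε.hasDerivWithinAt.sqrt hpos.ne').congr_deriv ?_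
  have hsqrt : √(ε r) ≠ 0 := (Real.sqrt_pos.2 hpos).ne'
  rw [amplitudeLogDeriv]
  field_simp
  rw [Real.sq_sqrt hpos.le]
  ring

lemma hasDerivWithinAt_waveRate (hε : DifferentiableWithinAt ℝ ε (Icc 0 1) r) (hpos : 0 < ε r)
    (hp : DifferentiableWithinAt ℝ (damping ε γ) (Icc 0 1) r) (k : ℂ) :
    HasDerivWithinAt (waveRate ε γ k)
      (-2 * amplitudeLogDeriv ε r * (Complex.I * k * √(ε r))
        - derivWithin (damping ε γ) (Icc 0 1) r) (Icc 0 1) r := by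
  refine (((hasDerivWithinAt_sqrt hε hpos).ofReal_comp.const_mul (Complex.I * k)).sub
    hp.hasDerivWithinAt.ofReal_comp).congr_deriv ?_
  push_cast
  ring

lemma waveRate_sq (hpos : 0 < ε r) (k : ℂ) :
    waveRate ε γ k r ^ 2
      = (damping ε γ r : ℂ) ^ 2 - (k ^ 2 * ε r + Complex.I * k * γ r) := by
  have hsqrt : (√(ε r) : ℂ) ^ 2 = ε r := mod_cast Real.sq_sqrt hpos.le
  have hγ : (γ r : ℂ) = 2 * √(ε r) * damping ε γ r := by
    have : √(ε r) ≠ 0 := (Real.sqrt_pos.2 hpos).ne'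
    have hγ : γ r = 2 * √(ε r) * damping ε γ r := by rw [damping]; field_simp
    exact mod_cast hγ
  rw [waveRate, hγ, ← hsqrt]
  linear_combination (k ^ 2 * (√(ε r) : ℂ) ^ 2) * Complex.I_sq

end Derivatives

theorem IsSolution.hasDerivWithinAt_waveComponent {k : ℂ} {u u' : ℝ → ℂ}
    (hu : IsSolution ε γ k u u') (hε : ContDiffOn ℝ 2 ε (Icc 0 1))
    (hγ : ContDiffOn ℝ 1 γ (Icc 0 1)) (hpos : ∀ r ∈ Icc (0 : ℝ) 1, 0 < ε r) (s : ℤˣ) {r : ℝ}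
    (hr : r ∈ Icc (0 : ℝ) 1) :
    HasDerivWithinAt (fun r => waveComponent ε γ k u u' r s)
      ((s : ℤ) * waveRate ε γ k r * waveComponent ε γ k u u' r s
        + waveDefect ε γ r s * (amplitude ε r * u r)) (Icc 0 1) r := by
  have hεd := hε.differentiableOn two_ne_zero r hr
  have hpd := (contDiffOn_damping (hε.of_le one_le_two) hγ hpos).differentiableOn one_ne_zero r hr
  have hld := (contDiffOn_amplitudeLogDeriv hε hpos).differentiableOn one_ne_zero r hr
  have ha := (hasDerivWithinAt_amplitude hεd (hpos r hr)).ofReal_comp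
  rw [Complex.ofReal_mul] at ha
  refine (hasDerivWithinAt_mul_add_mul (hu.hasDeriv r hr) (hu.hasDeriv' r hr) ha
    hld.hasDerivWithinAt.ofReal_comp
    ((hasDerivWithinAt_waveRate hεd (hpos r hr) hpd k).const_mul ((s : ℤ) : ℂ))).congr_deriv ?_
  have hs : ((s : ℤ) : ℂ) ^ 2 = 1 := mod_cast Int.units_coe_mul_self s ▸ sq (s : ℤ)
  rw [waveComponent, mul_pow, hs, one_mul, waveRate_sq (hpos r hr)]
  simp only [waveDefect, waveRate]
  push_cast
  ring

lemma waveComponent_apply_zero {k : ℂ} {u u' : ℝ → ℂ} (hu : IsSolution ε γ k u u') (s : ℤˣ) :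
    waveComponent ε γ k u u' 0 s = amplitude ε 0 := by
  simp [waveComponent, hu.init, hu.init']

lemma norm_waveComponent_zero {k : ℂ} {u u' : ℝ → ℂ} (hu : IsSolution ε γ k u u') :
    ‖waveComponent ε γ k u u' 0‖ = |amplitude ε 0| := by
  have h : waveComponent ε γ k u u' 0 = fun _ => (amplitude ε 0 : ℂ) :=
    funext (waveComponent_apply_zero hu)
  rw [h, pi_norm_const, Complex.norm_real, Real.norm_eq_abs]

lemma waveComponent_one_sub_neg_one (k : ℂ) (u u' : ℝ → ℂ) (r : ℝ) :
    waveComponent ε γ k u u' r 1 - waveComponent ε γ k u u' r (-1)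
      = 2 * waveRate ε γ k r * (amplitude ε r * u r) := by
  simp only [waveComponent, Units.val_neg, Units.val_one, Int.cast_neg, Int.cast_one]
  ring

lemma waveComponent_one_add_neg_one (k : ℂ) (u u' : ℝ → ℂ) (r : ℝ) :
    waveComponent ε γ k u u' r 1 + waveComponent ε γ k u u' r (-1)
      = 2 * (amplitude ε r * u' r) - 2 * amplitudeLogDeriv ε r * (amplitude ε r * u r) := by
  simp only [waveComponent, Units.val_neg, Units.val_one, Int.cast_neg, Int.cast_one]
  ring

lemma norm_waveRate_mul_le (k : ℂ) (u u' : ℝ → ℂ) (r : ℝ) :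
    ‖waveRate ε γ k r‖ * ‖amplitude ε r * u r‖ ≤ ‖waveComponent ε γ k u u' r‖ := by
  have h : ‖2 * waveRate ε γ k r * (amplitude ε r * u r)‖ ≤ _ :=
    waveComponent_one_sub_neg_one k u u' r ▸ norm_sub_le_of_le
      (norm_le_pi_norm (waveComponent ε γ k u u' r) 1)
      (norm_le_pi_norm (waveComponent ε γ k u u' r) (-1))
  rw [mul_assoc, norm_mul, norm_mul, Complex.norm_two] at h
  linarith

lemma exists_norm_le_mul_norm_waveRate (hε : ContinuousOn ε (Icc 0 1))
    (hp : ContinuousOn (damping ε γ) (Icc 0 1)) (hpos : ∀ r ∈ Icc (0 : ℝ) 1, 0 < ε r) :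
    ∃ M, 0 ≤ M ∧ ∀ᶠ k : ℂ in cobounded ℂ, ∀ r ∈ Icc (0 : ℝ) 1, ‖k‖ ≤ M * ‖waveRate ε γ k r‖ := by
  obtain ⟨r₀, hr₀, hmin⟩ := isCompact_Icc.exists_isMinOn (nonempty_Icc.2 zero_le_one) hε.sqrt
  obtain ⟨b, hb⟩ := isCompact_Icc.exists_bound_of_continuousOn hp
  set m : ℝ := √(ε r₀)
  have hm : 0 < m := Real.sqrt_pos.2 (hpos r₀ hr₀)
  refine ⟨2 / m, by positivity, ?_⟩
  filter_upwards [tendsto_norm_cobounded_atTop.eventually_ge_atTop (2 * b / m)] with k hk r hr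
  have hmr : m ≤ √(ε r) := hmin hr
  have hrate : m * ‖k‖ - b ≤ ‖waveRate ε γ k r‖ := by
    calc m * ‖k‖ - b ≤ ‖Complex.I * k * √(ε r)‖ - ‖(damping ε γ r : ℂ)‖ := by
          rw [norm_mul, norm_mul, Complex.norm_I, one_mul, Complex.norm_real, Complex.norm_real,
            Real.norm_of_nonneg (Real.sqrt_nonneg _), mul_comm m]
          gcongr
          exact hb r hr
      _ ≤ ‖waveRate ε γ k r‖ := norm_sub_norm_le _ _
  rw [div_le_iff₀ hm] at hk
  rw [div_mul_eq_mul_div, le_div_iff₀ hm]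
  linarith

lemma exists_norm_waveDefect_mul_le (hε : ContDiffOn ℝ 2 ε (Icc 0 1))
    (hγ : ContDiffOn ℝ 1 γ (Icc 0 1)) (hpos : ∀ r ∈ Icc (0 : ℝ) 1, 0 < ε r) :
    ∃ M, 0 ≤ M ∧ ∀ᶠ k : ℂ in cobounded ℂ, ∀ (u u' : ℝ → ℂ) (s : ℤˣ), ∀ r ∈ Icc (0 : ℝ) 1,
      ‖waveDefect ε γ r s * (amplitude ε r * u r)‖
        ≤ M / ‖k‖ * ‖waveComponent ε γ k u u' r‖ := by
  obtain ⟨G, hG⟩ := isCompact_Icc.exists_bound_of_continuousOn (s := Icc (0 : ℝ) 1)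
    (f := waveDefect ε γ) (continuousOn_pi.2 (continuousOn_waveDefect hε hγ hpos))
  have hG0 : 0 ≤ G := (norm_nonneg _).trans (hG 0 ⟨le_rfl, zero_le_one⟩)
  obtain ⟨M, hM0, hM⟩ := exists_norm_le_mul_norm_waveRate hε.continuousOn
    (contDiffOn_damping (hε.of_le one_le_two) hγ hpos).continuousOn hpos
  refine ⟨G * M, mul_nonneg hG0 hM0, ?_⟩
  filter_upwards [hM, tendsto_norm_cobounded_atTop.eventually_gt_atTop 0] with k hkM hk0 u u' s r hr
  rw [norm_mul, Complex.norm_real, div_mul_eq_mul_div, le_div_iff₀ hk0]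
  calc ‖waveDefect ε γ r s‖ * ‖amplitude ε r * u r‖ * ‖k‖
      ≤ G * ‖amplitude ε r * u r‖ * (M * ‖waveRate ε γ k r‖) := by
        gcongr
        exacts [(norm_le_pi_norm _ s).trans (hG r hr), hkM r hr]
    _ = G * M * (‖waveRate ε γ k r‖ * ‖amplitude ε r * u r‖) := by ring
    _ ≤ G * M * ‖waveComponent ε γ k u u' r‖ := by
        gcongr
        exact norm_waveRate_mul_le k u u' r

lemma hasDerivWithinAt_wavePhase (hε : ContinuousOn ε (Icc 0 1))
    (hp : ContinuousOn (damping ε γ) (Icc 0 1)) (k : ℂ) {r : ℝ} (hr : r ∈ Icc (0 : ℝ) 1) :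
    HasDerivWithinAt (wavePhase ε γ k) (waveRate ε γ k r) (Icc 0 1) r :=
  ((hasDerivWithinAt_integral_Icc hε.sqrt hr).ofReal_comp.const_mul (Complex.I * k)).sub
    (hasDerivWithinAt_integral_Icc hp hr).ofReal_comp

lemma monotoneOn_integral_sqrt (hε : ContinuousOn ε (Icc 0 1)) :
    MonotoneOn (fun r => ∫ t in (0 : ℝ)..r, √(ε t)) (Icc 0 1) := by
  have hderiv := fun r hr => hasDerivWithinAt_integral_Icc (r := r) hε.sqrt hr
  exact monotoneOn_of_hasDerivWithinAt_nonneg (convex_Icc 0 1)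
    (fun r hr => (hderiv r hr).continuousWithinAt)
    (fun r hr => (hderiv r (interior_subset hr)).mono interior_subset)
    fun r _ => Real.sqrt_nonneg _

lemma exists_re_wavePhase_sub_le (hε : ContinuousOn ε (Icc 0 1))
    (hp : ContinuousOn (damping ε γ) (Icc 0 1)) :
    ∃ c, ∀ (k : ℂ) (s : ℤˣ), ∀ r ∈ Icc (0 : ℝ) 1, ∀ t ∈ Icc (0 : ℝ) r,
      ((s : ℤ) * wavePhase ε γ k r - (s : ℤ) * wavePhase ε γ k t).re
        ≤ c + (|k.im| * (∫ x in (0 : ℝ)..r, √(ε x)) - |k.im| * ∫ x in (0 : ℝ)..t, √(ε x)) := by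
  obtain ⟨c, hc⟩ := isCompact_Icc.exists_bound_of_continuousOn (s := Icc (0 : ℝ) 1)
    (f := fun r => ∫ t in (0 : ℝ)..r, damping ε γ t)
    fun r hr => (hasDerivWithinAt_integral_Icc hp hr).continuousWithinAt
  refine ⟨c + c, fun k s r hr t ht => ?_⟩
  have ht' : t ∈ Icc (0 : ℝ) 1 := ⟨ht.1, ht.2.trans hr.2⟩
  set Q := fun r => ∫ x in (0 : ℝ)..r, √(ε x)
  set P := fun r => ∫ x in (0 : ℝ)..r, damping ε γ x
  have hQ : 0 ≤ Q r - Q t := sub_nonneg.2 (monotoneOn_integral_sqrt hε ht' hr ht.2)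
  calc ((s : ℤ) * wavePhase ε γ k r - (s : ℤ) * wavePhase ε γ k t).re
      ≤ |(wavePhase ε γ k r - wavePhase ε γ k t).re| := by
        rw [← mul_sub]
        rcases Int.units_eq_one_or s with rfl | rfl
        · rw [Units.val_one, Int.cast_one, one_mul]
          exact le_abs_self _
        · rw [Units.val_neg, Units.val_one, Int.cast_neg, Int.cast_one, neg_one_mul]
          exact neg_le_abs _
    _ = |-(k.im * (Q r - Q t)) - (P r - P t)| := by
        congr 1
        simp [wavePhase, Q, P]
        ring
    _ ≤ |k.im * (Q r - Q t)| + (|P r| + |P t|) := by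
        rw [← abs_neg (k.im * _)]
        exact (abs_sub _ _).trans (by gcongr; exact abs_sub _ _)
    _ ≤ c + c + (|k.im| * Q r - |k.im| * Q t) := by
        rw [abs_mul, abs_of_nonneg hQ]
        have hPr : |P r| ≤ c := hc r hr
        have hPt : |P t| ≤ c := hc t ht'
        linarith

theorem isBigO_waveComponent_sub_cexp (hε : ContDiffOn ℝ 2 ε (Icc 0 1))
    (hγ : ContDiffOn ℝ 1 γ (Icc 0 1)) (hpos : ∀ r ∈ Icc (0 : ℝ) 1, 0 < ε r)
    {y y' : ℝ → ℂ → ℂ} (hy : ∀ k : ℂ, IsSolution ε γ k (fun r => y r k) (fun r => y' r k))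
    (s : ℤˣ) :
    (fun k => waveComponent ε γ k (fun r => y r k) (fun r => y' r k) 1 s
        - Complex.exp ((s : ℤ) * wavePhase ε γ k 1) * amplitude ε 0)
      =O[cobounded ℂ] fun k => Real.exp (|k.im| * constB ε) / ‖k‖ := by
  have hεc := hε.continuousOn
  have hpc := (contDiffOn_damping (hε.of_le one_le_two) hγ hpos).continuousOn
  obtain ⟨M, hM0, hM⟩ := exists_norm_waveDefect_mul_le hε hγ hpos
  obtain ⟨c, hc⟩ := exists_re_wavePhase_sub_le hεc hpc
  refine IsBigO.of_bound (2 * Real.exp c ^ 2 * M * |amplitude ε 0|) ?_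
  filter_upwards [hM, tendsto_norm_cobounded_atTop.eventually_ge_atTop (2 * Real.exp c * M),
    tendsto_norm_cobounded_atTop.eventually_gt_atTop 0] with k hkM hkc hk0
  have hsystem := norm_sub_cexp_mul_le_of_weaklyCoupled
    (x := waveComponent ε γ k (fun r => y r k) (fun r => y' r k))
    (Θ := fun s r => (s : ℤ) * wavePhase ε γ k r)
    (S := fun r => |k.im| * ∫ t in (0 : ℝ)..r, √(ε t))
    (fun s r hr => (hy k).hasDerivWithinAt_waveComponent hε hγ hpos s hr)
    (fun s r hr => (hasDerivWithinAt_wavePhase hεc hpc k hr).const_mul _)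
    (fun r hr => ((hasDerivWithinAt_integral_Icc hεc.sqrt hr).const_mul _).continuousWithinAt)
    (hc k) (hkM (fun r => y r k) (fun r => y' r k)) (by positivity)
    (by rw [sub_zero, mul_one, mul_div_assoc', div_le_one hk0]; exact hkc)
    ⟨zero_le_one, le_rfl⟩ s
  rw [waveComponent_apply_zero (hy k), norm_waveComponent_zero (hy k)] at hsystem
  rw [Real.norm_of_nonneg (by positivity)]
  refine (le_of_eq_of_le ?_ hsystem).trans_eq ?_
  · simp [wavePhase]
  · simp only [intervalIntegral.integral_same, mul_zero, sub_zero, constB]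
    ring

lemma wavePhase_one (k : ℂ) :
    wavePhase ε γ k 1 = (constB ε * k + Complex.I * constD ε γ) * Complex.I := by
  have hD : (∫ t in (0 : ℝ)..1, damping ε γ t) = constD ε γ := by
    rw [constD, ← intervalIntegral.integral_const_mul]
    congr with t
    rw [damping]
    ring
  rw [wavePhase, hD, ← constB]
  linear_combination -(constD ε γ : ℂ) * Complex.I_sq

lemma amplitude_pos {r : ℝ} (hpos : 0 < ε r) : 0 < amplitude ε r := Real.rpow_pos_of_pos hpos _

variable {y y' : ℝ → ℂ → ℂ}

lemma isBigO_waveComponent (hε : ContDiffOn ℝ 2 ε (Icc 0 1))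
    (hγ : ContDiffOn ℝ 1 γ (Icc 0 1)) (hpos : ∀ r ∈ Icc (0 : ℝ) 1, 0 < ε r)
    (hy : ∀ k : ℂ, IsSolution ε γ k (fun r => y r k) (fun r => y' r k)) :
    (fun k => waveComponent ε γ k (fun r => y r k) (fun r => y' r k) 1)
      =O[cobounded ℂ] fun k => Real.exp (|k.im| * constB ε) := by
  obtain ⟨c, hc⟩ := exists_re_wavePhase_sub_le hε.continuousOn
    (contDiffOn_damping (hε.of_le one_le_two) hγ hpos).continuousOn
  refine isBigO_pi.2 fun s => ?_
  have hexp : (fun k => Complex.exp ((s : ℤ) * wavePhase ε γ k 1) * amplitude ε 0)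
      =O[cobounded ℂ] fun k => Real.exp (|k.im| * constB ε) := by
    refine IsBigO.of_bound (Real.exp c * |amplitude ε 0|) (Eventually.of_forall fun k => ?_)
    have hre : ((s : ℤ) * wavePhase ε γ k 1).re ≤ c + |k.im| * constB ε := by
      simpa [wavePhase, constB] using hc k s 1 ⟨zero_le_one, le_rfl⟩ 0 ⟨le_rfl, zero_le_one⟩
    rw [norm_mul, Complex.norm_exp, Complex.norm_real, Real.norm_eq_abs, Real.norm_eq_abs,
      Real.abs_exp, mul_right_comm, ← Real.exp_add]
    gcongr
  have hdiv : (fun k : ℂ => Real.exp (|k.im| * constB ε) / ‖k‖)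
      =O[cobounded ℂ] fun k => Real.exp (|k.im| * constB ε) := by
    refine IsBigO.of_bound 1 ?_
    filter_upwards [tendsto_norm_cobounded_atTop.eventually_ge_atTop 1] with k hk
    rw [one_mul, norm_div, norm_norm]
    exact div_le_self (norm_nonneg _) hk
  simpa using ((isBigO_waveComponent_sub_cexp hε hγ hpos hy s).trans hdiv).add hexp

lemma isBigO_amplitude_mul (hε : ContDiffOn ℝ 2 ε (Icc 0 1))
    (hγ : ContDiffOn ℝ 1 γ (Icc 0 1)) (hpos : ∀ r ∈ Icc (0 : ℝ) 1, 0 < ε r)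
    (hy : ∀ k : ℂ, IsSolution ε γ k (fun r => y r k) (fun r => y' r k)) :
    (fun k => amplitude ε 1 * y 1 k)
      =O[cobounded ℂ] fun k => Real.exp (|k.im| * constB ε) / ‖k‖ := by
  obtain ⟨M, hM0, hM⟩ := exists_norm_le_mul_norm_waveRate hε.continuousOn
    (contDiffOn_damping (hε.of_le one_le_two) hγ hpos).continuousOn hpos
  obtain ⟨C, hC⟩ := (isBigO_waveComponent hε hγ hpos hy).bound
  refine IsBigO.of_bound (M * C) ?_
  filter_upwards [hM, hC, tendsto_norm_cobounded_atTop.eventually_gt_atTop 0] with k hkM hkC hk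
  rw [norm_div, norm_norm, mul_div_assoc', le_div_iff₀' hk]
  calc ‖k‖ * ‖amplitude ε 1 * y 1 k‖ ≤ M * ‖waveRate ε γ k 1‖ * ‖amplitude ε 1 * y 1 k‖ := by
        gcongr
        exact hkM 1 ⟨zero_le_one, le_rfl⟩
    _ ≤ M * (C * ‖Real.exp (|k.im| * constB ε)‖) := by
        rw [mul_assoc]
        exact mul_le_mul_of_nonneg_left
          ((norm_waveRate_mul_le k (fun r => y r k) (fun r => y' r k) 1).trans hkC) hM0
    _ = M * C * ‖Real.exp (|k.im| * constB ε)‖ := (mul_assoc _ _ _).symm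

theorem isBigO_solution_sub_sin (hε : ContDiffOn ℝ 2 ε (Icc 0 1))
    (hγ : ContDiffOn ℝ 1 γ (Icc 0 1)) (hpos : ∀ r ∈ Icc (0 : ℝ) 1, 0 < ε r)
    (hy : ∀ k : ℂ, IsSolution ε γ k (fun r => y r k) (fun r => y' r k)) :
    (fun k => (√(ε 1) * amplitude ε 1 / amplitude ε 0 : ℝ) * (k * y 1 k)
        - Complex.sin (constB ε * k + Complex.I * constD ε γ))
      =O[cobounded ℂ] fun k => Real.exp (|k.im| * constB ε) / ‖k‖ := by
  have hX := isBigO_waveComponent_sub_cexp hε hγ hpos hy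
  have hu := (isBigO_amplitude_mul hε hγ hpos hy).const_mul_left (2 * damping ε γ 1 : ℂ)
  have ha : (amplitude ε 0 : ℂ) ≠ 0 :=
    Complex.ofReal_ne_zero.2 (amplitude_pos (hpos 0 ⟨le_rfl, zero_le_one⟩)).ne'
  refine ((((hX 1).sub (hX (-1))).add hu).const_mul_left
    (2 * Complex.I * amplitude ε 0)⁻¹).congr_left fun k => ?_
  rw [sub_sub_sub_comm, waveComponent_one_sub_neg_one, wavePhase_one, Complex.sin, waveRate,
    inv_mul_eq_iff_eq_mul₀ (by simp [ha])]
  generalize (constB ε * k + Complex.I * constD ε γ : ℂ) = θ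
  simp only [Units.val_neg, Units.val_one, Int.cast_neg, Int.cast_one, one_mul, neg_mul,
    Complex.ofReal_div, Complex.ofReal_mul]
  field_simp
  linear_combination amplitude ε 0 *
    (Complex.exp (-(Complex.I * θ)) - Complex.exp (Complex.I * θ)) * Complex.I_sq

theorem isBigO_deriv_solution_sub_cos (hε : ContDiffOn ℝ 2 ε (Icc 0 1))
    (hγ : ContDiffOn ℝ 1 γ (Icc 0 1)) (hpos : ∀ r ∈ Icc (0 : ℝ) 1, 0 < ε r)
    (hy : ∀ k : ℂ, IsSolution ε γ k (fun r => y r k) (fun r => y' r k)) :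
    (fun k => (amplitude ε 1 / amplitude ε 0 : ℝ) * y' 1 k
        - Complex.cos (constB ε * k + Complex.I * constD ε γ))
      =O[cobounded ℂ] fun k => Real.exp (|k.im| * constB ε) / ‖k‖ := by
  have hX := isBigO_waveComponent_sub_cexp hε hγ hpos hy
  have hu := (isBigO_amplitude_mul hε hγ hpos hy).const_mul_left (2 * amplitudeLogDeriv ε 1 : ℂ)
  have ha : (amplitude ε 0 : ℂ) ≠ 0 :=
    Complex.ofReal_ne_zero.2 (amplitude_pos (hpos 0 ⟨le_rfl, zero_le_one⟩)).ne'
  refine ((((hX 1).add (hX (-1))).add hu).const_mul_left (2 * amplitude ε 0 : ℂ)⁻¹).congr_left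
    fun k => ?_
  rw [sub_add_sub_comm, waveComponent_one_add_neg_one, wavePhase_one, Complex.cos]
  generalize (constB ε * k + Complex.I * constD ε γ : ℂ) = θ
  simp only [Units.val_neg, Units.val_one, Int.cast_neg, Int.cast_one, one_mul, neg_mul,
    Complex.ofReal_div]
  field_simp
  ring

lemma constB_pos (hε : ContinuousOn ε (Icc 0 1))
    (hpos : ∀ r ∈ Icc (0 : ℝ) 1, 0 < ε r) : 0 < constB ε := by
  refine intervalIntegral.intervalIntegral_pos_of_pos_on (ContinuousOn.intervalIntegrable ?_)
    (fun r hr => Real.sqrt_pos.2 (hpos r (Ioo_subset_Icc_self hr))) zero_lt_one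
  rw [uIcc_of_le zero_le_one]
  exact hε.sqrt

end LiouvilleGreen

lemma exists_norm_le_div_abs_of_isBigO {E : Type*} [NormedAddCommGroup E] {u : ℤ → E}
    (hu : u =O[cofinite] fun j => (j : ℝ)⁻¹) : ∃ C : ℝ, ∀ j : ℤ, j ≠ 0 → ‖u j‖ ≤ C / |(j : ℝ)| := by
  obtain ⟨C, -, hC⟩ := bound_of_isBigO_cofinite hu
  refine ⟨C, fun j hj => (hC (inv_ne_zero (Int.cast_ne_zero.2 hj))).trans_eq ?_⟩
  rw [norm_inv, Real.norm_eq_abs, div_eq_mul_inv]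

end InteriorTransmission

open InteriorTransmission in
theorem proposition3p3_general (ε γ : ℝ → ℝ)
    (hε : ContDiffOn ℝ 2 ε (Set.Icc 0 1)) (hγ : ContDiffOn ℝ 1 γ (Set.Icc 0 1))
    (hεpos : ∀ r ∈ Set.Icc (0 : ℝ) 1, 0 < ε r) (y y' : ℝ → ℂ → ℂ)
    (hy : ∀ k : ℂ, IsSolution ε γ k (fun r => y r k) (fun r => y' r k)) :
    (∃ z : ℤ → ℂ, EnumeratesZeros (fun k => y 1 k) {j : ℤ | j ≠ 0} z ∧
      ∃ C : ℝ, ∀ j : ℤ, j ≠ 0 →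
        ‖z j - ((j : ℂ) * (Real.pi : ℂ) / (constB ε : ℂ)
            - Complex.I * (constD ε γ : ℂ) / (constB ε : ℂ))‖ ≤ C / |(j : ℝ)|) ∧
    (∃ z' : ℤ → ℂ, EnumeratesZeros (fun k => y' 1 k) Set.univ z' ∧
      ∃ C : ℝ, ∀ j : ℤ, j ≠ 0 →
        ‖z' j - (((j : ℂ) - 1 / 2) * (Real.pi : ℂ) / (constB ε : ℂ)
            - Complex.I * (constD ε γ : ℂ) / (constB ε : ℂ))‖ ≤ C / |(j : ℝ)|) := by
  have hB := constB_pos hε.continuousOn hεpos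
  have ha₀ := amplitude_pos (hεpos 0 ⟨le_rfl, zero_le_one⟩)
  have hε₁ := hεpos 1 ⟨zero_le_one, le_rfl⟩
  have hd := differentiable_prod_of_isSolution hε.continuousOn hγ.continuousOn hy
    (r := 1) ⟨zero_le_one, le_rfl⟩
  constructor
  · obtain ⟨w, hw, hwO⟩ := exists_enumeratesZeros_of_isBigO_sub_sin_affine hB
      ((differentiable_fun_id.fun_mul hd.fst).const_mul _) (isBigO_solution_sub_sin hε hγ hεpos hy)
    have hc : ((√(ε 1) * amplitude ε 1 / amplitude ε 0 : ℝ) : ℂ) ≠ 0 := Complex.ofReal_ne_zero.2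
      (div_pos (mul_pos (Real.sqrt_pos.2 hε₁) (amplitude_pos hε₁)) ha₀).ne'
    obtain ⟨z, hz, hzw⟩ := EnumeratesZeros.exists_of_sub_mul hd.fst (a := 0)
      (by simpa only [sub_zero] using hw.of_const_mul hc) 0
    refine ⟨z, hz, exists_norm_le_div_abs_of_isBigO (hwO.congr' ?_ .rfl)⟩
    filter_upwards [hzw] with j hj
    rw [hj, sub_div]
  · obtain ⟨w, hw, hwO⟩ := exists_enumeratesZeros_of_isBigO_sub_sin_affine hB
      (δ := Complex.I * constD ε γ + Real.pi / 2) (hd.snd.const_mul _)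
      (by simpa only [← add_assoc, Complex.sin_add_pi_div_two]
        using isBigO_deriv_solution_sub_cos hε hγ hεpos hy)
    have hc : ((amplitude ε 1 / amplitude ε 0 : ℝ) : ℂ) ≠ 0 :=
      Complex.ofReal_ne_zero.2 (div_pos (amplitude_pos hε₁) ha₀).ne'
    refine ⟨w, hw.of_const_mul hc, exists_norm_le_div_abs_of_isBigO (hwO.congr_left fun j => ?_)⟩
    ring

theorem proposition3p3 (ε γ : ℝ → ℝ)
    (hε : ContDiffOn ℝ 2 ε (Set.Icc 0 1)) (hγ : ContDiffOn ℝ 2 γ (Set.Icc 0 1))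
    (hεpos : ∀ r ∈ Set.Icc (0 : ℝ) 1, 0 < ε r) (hγnonneg : ∀ r ∈ Set.Icc (0 : ℝ) 1, 0 ≤ γ r)
    (y y' : ℝ → ℂ → ℂ)
    (hy : ∀ k : ℂ, InteriorTransmission.IsSolution ε γ k (fun r => y r k) (fun r => y' r k)) :
    (∃ z : ℤ → ℂ,
      InteriorTransmission.EnumeratesZeros (fun k => y 1 k) {j : ℤ | j ≠ 0} z ∧
      ∃ C : ℝ, ∀ j : ℤ, j ≠ 0 →
        ‖z j - ((j : ℂ) * (Real.pi : ℂ) / (InteriorTransmission.constB ε : ℂ)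
            - Complex.I * (InteriorTransmission.constD ε γ : ℂ)
                / (InteriorTransmission.constB ε : ℂ))‖ ≤ C / |(j : ℝ)|) ∧
    (∃ z' : ℤ → ℂ,
      InteriorTransmission.EnumeratesZeros (fun k => y' 1 k) Set.univ z' ∧
      ∃ C : ℝ, ∀ j : ℤ, j ≠ 0 →
        ‖z' j - (((j : ℂ) - 1 / 2) * (Real.pi : ℂ) / (InteriorTransmission.constB ε : ℂ)
            - Complex.I * (InteriorTransmission.constD ε γ : ℂ)
                / (InteriorTransmission.constB ε : ℂ))‖ ≤ C / |(j : ℝ)|) :=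
  proposition3p3_general ε γ hε (hγ.of_le one_le_two) hεpos y y' hy
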